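/- Work in Type-2 computability: a partial function $F:\subseteq\mathbb{N}^{\mathbb{N}}\to\mathbb{N}^{\mathbb{N}}$ is computable if some oracle machine, given oracle $p\in\mathrm{dom}(F)$ and input $n$, outputs $F(p)(n)$; $\langle p,q\rangle=p(0)q(0)p(1)q(1)\dots$ is the pairing on $\mathbb{N}^{\mathbb{N}}$. A represented space is a set $X$ with a surjective partial map $\sigma_X:\subseteq\mathbb{N}^{\mathbb{N}}\to X$; if $\sigma_X(p)=x$, then $p$ is called a name of $x$. A partial function $F:\subseteq\mathbb{N}^{\mathbb{N}}\to\mathbb{N}^{\mathbb{N}}$ realizes a partial multi-valued function $f:\subseteq X\rightrightarrows Y$ between represented spaces if $\sigma_Y(F(p))\in f(\sigma_X(p))$ whenever $\sigma_X(p)\in\mathrm{dom}(f)$. Write $f\le_{\mathrm W} g$ if there are computable $H,K:\subseteq\mathbb{N}^{\mathbb{N}}\to\mathbb{N}^{\mathbb{N}}$ such that $p\mapsto H\langle p,G(K(p))\rangle$ realizes $f$ whenever $G$ realizes $g$, and $f\equiv_{\mathrm W} g$ if $f\le_{\mathrm W} g$ and $g\le_{\mathrm W} f$. Let $(\alpha(n))_n$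 and $(q_m)_m$ be standard effective enumerations of $\mathbb{Q}$ and of $\mathbb{Q}_{\ge 0}$, and let $B_{\langle n,m\rangle}=\{x\in\mathbb{R}:|x-\alpha(n)|<q_m\}$. A name of $x\in\mathbb{R}$ is a $p$ with $|\alpha(p(i))-\alpha(p(j))|\le 2^{-i}$ for all $j\ge i$ and $\lim_n\alpha(p(n))=x$. A (total information) name of a nonempty closed $A\subseteq\mathbb{R}$ is a $\langle p_0,p_1\rangle$ with $A=\mathbb{R}\setminus\bigcup_{k\in\mathrm{range}(p_0)}B_k$ and $\mathrm{range}(p_1)=\{k: B_k\cap A\ne\emptyset\}$. Names of pairs are pairs of names, an element of $\mathbb{N}^{\mathbb{N}}$ is its own name, and $p$ is a name of $i\in\{0,1\}$ if $p(0)=i$. The total projection operator $\mathrm{Proj}_{\mathbb{R}}$ maps each pair $(x,A)$ of a point $x\in\mathbb{R}$ and a nonempty closed set $A\subseteq\mathbb{R}$ to the set of all $y\in A$ with $|x-y|=\inf_{z\in A}|x-z|$. The operator $\mathrm{LLPO}:\subseteq\mathbb{N}^{\mathbb{N}}\times\mathbb{N}^{\mathbb{N}}\rightrightarrows\{0,1\}$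 is defined on the pairs $(p_0,p_1)$ such that $p_j(n)\ne 0$ for at most one pair $(j,n)\in\{0,1\}\times\mathbb{N}$, and $i\in\mathrm{LLPO}(p_0,p_1)$ iff $p_i(n)=0$ for all $n$. Then $\mathrm{Proj}_{\mathbb{R}}\equiv_{\mathrm W}\mathrm{LLPO}$. -/

import Mathlib

namespace Weihrauch

/-- Baire space `ℕ^ℕ`. -/
abbrev Baire : Type := ℕ → ℕ

/-! ### Type-2 computability -/

/-- Partial recursive functionals `Φ : ℕ^ℕ × ℕ ⇀ ℕ`: the functions computed by oracle machines,
uniformly in the oracle `p`. These are the clauses of `Nat.RecursiveIn`, with the oracle kept as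
an argument of the functional. -/
inductive RecFunctional : (Baire → ℕ →. ℕ) → Prop
  | zero : RecFunctional fun _ _ => Part.some 0
  | succ : RecFunctional fun _ n => Part.some (n + 1)
  | left : RecFunctional fun _ n => Part.some n.unpair.1
  | right : RecFunctional fun _ n => Part.some n.unpair.2
  | oracle : RecFunctional fun p n => Part.some (p n)
  | pair {Φ Ψ : Baire → ℕ →. ℕ} (hΦ : RecFunctional Φ) (hΨ : RecFunctional Ψ) :
      RecFunctional fun p n => (Φ p n).bind fun a => (Ψ p n).map fun b => Nat.pair a b
  | comp {Φ Ψ : Baire → ℕ →. ℕ} (hΦ : RecFunctional Φ) (hΨ : RecFunctional Ψ) :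
      RecFunctional fun p n => (Ψ p n).bind (Φ p)
  | prec {Φ Ψ : Baire → ℕ →. ℕ} (hΦ : RecFunctional Φ) (hΨ : RecFunctional Ψ) :
      RecFunctional fun p n =>
        Nat.rec (motive := fun _ => Part ℕ) (Φ p n.unpair.1)
          (fun y ih => ih.bind fun i => Ψ p (Nat.pair n.unpair.1 (Nat.pair y i))) n.unpair.2
  | rfind {Φ : Baire → ℕ →. ℕ} (hΦ : RecFunctional Φ) :
      RecFunctional fun p a =>
        Nat.rfind fun n => (Φ p (Nat.pair a n)).map fun m => decide (m = 0)

/-- A partial function `F :⊆ ℕ^ℕ → ℕ^ℕ` is computable if some oracle machine outputs, on oracle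
`p` and input `n`, the value `F(p)(n)`; the domain of `F` consists of the `p` for which the machine
halts on every `n`. -/
def IsComputable (F : Baire →. Baire) : Prop :=
  ∃ Φ : Baire → ℕ →. ℕ, RecFunctional Φ ∧ ∀ p q, q ∈ F p ↔ ∀ n, q n ∈ Φ p n

/-- The pairing `⟨p, q⟩ = p(0) q(0) p(1) q(1) …` of Baire space. -/
def join (p q : Baire) : Baire := fun n => if n % 2 = 0 then p (n / 2) else q (n / 2)

/-- The first component of `r = ⟨p, q⟩`. -/
def fstPart (r : Baire) : Baire := fun n => r (2 * n)

/-- The second component of `r = ⟨p, q⟩`. -/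
def sndPart (r : Baire) : Baire := fun n => r (2 * n + 1)

theorem fstPart_join (p q : Baire) : fstPart (join p q) = p := by
  funext n
  simp [fstPart, join]

theorem sndPart_join (p q : Baire) : sndPart (join p q) = q := by
  funext n
  have h1 : (2 * n + 1) % 2 = 1 := by omega
  have h2 : (2 * n + 1) / 2 = n := by omega
  simp [sndPart, join, h1, h2]

/-! ### Represented spaces -/

/-- A representation of `X`: a surjective partial function `σ :⊆ ℕ^ℕ → X`, given by its graph
`Names p x ↔ σ(p) = x`. -/
structure Representation (X : Type) where
  Names : Baire → X → Prop
  unique : ∀ {p x y}, Names p x → Names p y → x = y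
  surj : ∀ x, ∃ p, Names p x

/-- Baire space, represented by the identity. -/
def baireRep : Representation Baire where
  Names p x := p = x
  unique h h' := h.symm.trans h'
  surj x := ⟨x, rfl⟩

/-- `{0, 1}` with the discrete representation: `p` names `i` iff `p(0) = i`. -/
def twoRep : Representation (Fin 2) where
  Names p i := p 0 = i
  unique h h' := Fin.ext (h.symm.trans h')
  surj i := ⟨fun _ => i, rfl⟩

/-- The product representation: `⟨p, q⟩` names `(x, y)` iff `p` names `x` and `q` names `y`. -/
def prodRep {X Y : Type} (σ : Representation X) (τ : Representation Y) :
    Representation (X × Y) where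
  Names r z := σ.Names (fstPart r) z.1 ∧ τ.Names (sndPart r) z.2
  unique h h' := Prod.ext (σ.unique h.1 h'.1) (τ.unique h.2 h'.2)
  surj z := by
    obtain ⟨p, hp⟩ := σ.surj z.1
    obtain ⟨q, hq⟩ := τ.surj z.2
    exact ⟨join p q, by rwa [fstPart_join], by rwa [sndPart_join]⟩

/-! ### Weihrauch reducibility -/

/-- A partial multi-valued function `f :⊆ X ⇉ Y` between represented spaces; its domain is
`{x | f x ≠ ∅}`. -/
structure Problem where
  {X Y : Type}
  repX : Representation X
  repY : Representation Y
  f : X → Set Y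

/-- `F ⊢ f`: for every name `p` of a point `x ∈ dom f`, `F(p)` is defined and names a point of
`f(x)`. -/
def Realizes (F : Baire →. Baire) (P : Problem) : Prop :=
  ∀ p x, P.repX.Names p x → (P.f x).Nonempty →
    ∃ q ∈ F p, ∃ y ∈ P.f x, P.repY.Names q y

/-- `P ≤_W Q`: there are computable `H`, `K` such that `p ↦ H⟨p, G(K(p))⟩` realizes `P` whenever
`G` realizes `Q`. -/
def Reducible (P Q : Problem) : Prop :=
  ∃ H K : Baire →. Baire, IsComputable H ∧ IsComputable K ∧
    ∀ G : Baire →. Baire, Realizes G Q →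
      Realizes (fun p => (K p).bind fun q => (G q).bind fun r => H (join p r)) P

/-- `P ≡_W Q`. -/
def Equivalent (P Q : Problem) : Prop := Reducible P Q ∧ Reducible Q P

/-- `LLPO`: given `(p₀, p₁)` such that `p_j(n) ≠ 0` for at most one pair `(j, n)`, find `i` with
`p_i = 0^ℕ`. -/
def LLPO : Problem where
  repX := prodRep baireRep baireRep
  repY := twoRep
  f p := {i | (∀ j j' : Fin 2, ∀ n n' : ℕ,
      ![p.1, p.2] j n ≠ 0 → ![p.1, p.2] j' n' ≠ 0 → j = j' ∧ n = n') ∧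
    ∀ n, ![p.1, p.2] i n = 0}

/-! ### Computable metric spaces and their hyperspaces of closed sets -/

/-- An effective enumeration of the nonnegative rationals: `q_⟨a, b⟩ = a / (b + 1)`. -/
def nnratEnum (m : ℕ) : ℚ := (m.unpair.1 : ℚ) / ((m.unpair.2 : ℚ) + 1)

/-- An effective enumeration of the rationals: `α(⟨⟨a, a'⟩, b⟩) = (a - a') / (b + 1)`. -/
def ratEnum (n : ℕ) : ℚ :=
  ((n.unpair.1.unpair.1 : ℚ) - (n.unpair.1.unpair.2 : ℚ)) / ((n.unpair.2 : ℚ) + 1)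

/-- A computable metric space structure on `X`: a dense sequence `α` such that `d(α(i), α(j))` is a
computable double sequence of reals. -/
structure ComputableMetric (X : Type) [MetricSpace X] where
  α : ℕ → X
  dense : DenseRange α
  computable_dist : ∃ g : ℕ × ℕ × ℕ → ℕ, Computable g ∧
    ∀ i j k, |dist (α i) (α j) - (nnratEnum (g (i, j, k)) : ℝ)| ≤ (1 / 2 : ℝ) ^ k

section Metric

variable {X : Type} [MetricSpace X] (C : ComputableMetric X)

/-- The Cauchy representation. -/
def cauchyRep : Representation X where
  Names p x := (∀ i j, i ≤ j → dist (C.α (p i)) (C.α (p j)) ≤ (1 / 2 : ℝ) ^ i) ∧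
    Filter.Tendsto (fun n => C.α (p n)) Filter.atTop (nhds x)
  unique h h' := tendsto_nhds_unique h.2 h'.2
  surj x := by
    have h : ∀ i : ℕ, ∃ n, dist x (C.α n) < (1 / 2 : ℝ) ^ (i + 1) := fun i =>
      C.dense.exists_dist_lt x (by positivity)
    choose p hp using h
    refine ⟨p, fun i j hij => ?_, ?_⟩
    · have h1 := dist_triangle_left (C.α (p i)) (C.α (p j)) x
      have h2 : (1 / 2 : ℝ) ^ (j + 1) ≤ (1 / 2 : ℝ) ^ (i + 1) :=
        pow_le_pow_of_le_one (by norm_num) (by norm_num) (by omega)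
      have h3 : (1 / 2 : ℝ) ^ (i + 1) = (1 / 2 : ℝ) ^ i / 2 := by ring
      linarith [hp i, hp j]
    · rw [tendsto_iff_dist_tendsto_zero]
      refine squeeze_zero (fun _ => dist_nonneg) (fun n => ?_)
        ((tendsto_pow_atTop_nhds_zero_of_lt_one (r := (1 / 2 : ℝ)) (by norm_num)
          (by norm_num)).comp (Filter.tendsto_add_atTop_nat 1))
      rw [dist_comm]
      exact (hp n).le

/-- The basic open ball `B_⟨n, m⟩ = B(α(n), q_m)`. -/
def basicBall (k : ℕ) : Set X := Metric.ball (C.α k.unpair.1) (nnratEnum k.unpair.2 : ℝ)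

/-- `p` is a negative-information name of `A`: it enumerates basic balls exhausting the
complement of `A`. -/
def NegName (p : Baire) (A : Set X) : Prop := A = (⋃ k ∈ Set.range p, basicBall C k)ᶜ

/-- `p` is a positive-information name of `A`: it enumerates exactly the basic balls that
meet `A`. -/
def PosName (p : Baire) (A : Set X) : Prop :=
  ∀ k, k ∈ Set.range p ↔ (basicBall C k ∩ A).Nonempty

theorem exists_basicBall {U : Set X} (hU : IsOpen U) {x : X} (hx : x ∈ U) :
    ∃ k, x ∈ basicBall C k ∧ basicBall C k ⊆ U := by
  obtain ⟨ε, hε, hεU⟩ := Metric.isOpen_iff.1 hU x hx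
  obtain ⟨b, hb⟩ := exists_nat_one_div_lt (half_pos hε)
  obtain ⟨n, hn⟩ := C.dense.exists_dist_lt x (ε := 1 / ((b : ℝ) + 1)) (by positivity)
  refine ⟨Nat.pair n (Nat.pair 1 b), ?_, fun y hy => hεU ?_⟩
  · simpa [basicBall, nnratEnum] using hn
  · have hy' : dist y (C.α n) < 1 / ((b : ℝ) + 1) := by simpa [basicBall, nnratEnum] using hy
    have := dist_triangle_right y x (C.α n)
    rw [Metric.mem_ball]
    linarith

theorem exists_negName {A : Set X} (hA : IsClosed A) : ∃ p, NegName C p A := by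
  have hne : {k | basicBall C k ⊆ Aᶜ}.Nonempty :=
    ⟨Nat.pair 0 (Nat.pair 0 0), by simp [basicBall, nnratEnum]⟩
  obtain ⟨p, hp⟩ := (Set.to_countable {k | basicBall C k ⊆ Aᶜ}).exists_eq_range hne
  refine ⟨p, ?_⟩
  rw [NegName, ← hp, eq_compl_comm]
  refine Set.Subset.antisymm (Set.iUnion₂_subset fun k hk => hk) fun x hx => ?_
  obtain ⟨k, hxk, hk⟩ := exists_basicBall C hA.isOpen_compl hx
  exact Set.mem_biUnion (s := {k | basicBall C k ⊆ Aᶜ}) hk hxk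

theorem exists_posName {A : Set X} (hA : A.Nonempty) : ∃ p, PosName C p A := by
  have hne : {k | (basicBall C k ∩ A).Nonempty}.Nonempty := by
    obtain ⟨x, hx⟩ := hA
    obtain ⟨k, hk, -⟩ := exists_basicBall C isOpen_univ (Set.mem_univ x)
    exact ⟨k, x, hk, hx⟩
  obtain ⟨p, hp⟩ := (Set.to_countable _).exists_eq_range hne
  exact ⟨p, fun k => by rw [← hp]; rfl⟩

/-- The nonempty closed subsets of `X`. The empty set has no positive name, since the range of a
sequence is nonempty, and it is outside the domain of the projection operators. -/
abbrev NonemptyClosed (X : Type) [MetricSpace X] : Type :=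
  {A : Set X // IsClosed A ∧ A.Nonempty}

/-- The total-information representation: `⟨p₀, p₁⟩` names `A` iff `p₀` is a negative and `p₁` a
positive name of `A`. -/
def totalRep : Representation (NonemptyClosed X) where
  Names r A := NegName C (fstPart r) A ∧ PosName C (sndPart r) A
  unique h h' := Subtype.ext (Eq.trans h.1 (Eq.symm h'.1))
  surj A := by
    obtain ⟨p, hp⟩ := exists_negName C A.2.1
    obtain ⟨q, hq⟩ := exists_posName C A.2.2
    exact ⟨join p q, by rwa [fstPart_join], by rwa [sndPart_join]⟩

/-- The exact total projection operator `Proj_X`: given `x` and a nonempty closed `A`, find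
`y ∈ A` with `d(x, y) = d(x, A)`. -/
noncomputable def Proj : Problem where
  repX := prodRep (cauchyRep C) (totalRep C)
  repY := cauchyRep C
  f z := {y | y ∈ z.2.1 ∧ dist z.1 y = Metric.infDist z.1 z.2.1}

end Metric

theorem ratEnum_surjective : Function.Surjective ratEnum := by
  intro q
  refine ⟨Nat.pair (Nat.pair q.num.toNat (-q.num).toNat) (q.den - 1), ?_⟩
  have h1 : ((q.num.toNat : ℚ) - ((-q.num).toNat : ℚ)) = (q.num : ℚ) := by
    have : ((q.num.toNat : ℤ) - ((-q.num).toNat : ℤ)) = q.num := by omega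
    exact_mod_cast this
  have h2 : ((q.den - 1 : ℕ) : ℚ) + 1 = q.den := by
    have : q.den - 1 + 1 = q.den := Nat.sub_add_cancel q.pos
    exact_mod_cast this
  simp only [ratEnum, Nat.unpair_pair, h1, h2, Rat.num_div_den]

/-- The (exact) distance of two rationals, on codes. -/
def ratDistCode (i j : ℕ) : ℕ :=
  let u := i.unpair.1.unpair.1 * (j.unpair.2 + 1) + j.unpair.1.unpair.2 * (i.unpair.2 + 1)
  let v := i.unpair.1.unpair.2 * (j.unpair.2 + 1) + j.unpair.1.unpair.1 * (i.unpair.2 + 1)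
  Nat.pair ((u - v) + (v - u)) ((i.unpair.2 + 1) * (j.unpair.2 + 1) - 1)

theorem nnratEnum_ratDistCode (i j : ℕ) :
    nnratEnum (ratDistCode i j) = |ratEnum i - ratEnum j| := by
  simp only [nnratEnum, ratDistCode, ratEnum, Nat.unpair_pair]
  generalize i.unpair.1.unpair.1 = a
  generalize i.unpair.1.unpair.2 = a'
  generalize i.unpair.2 = b
  generalize j.unpair.1.unpair.1 = c
  generalize j.unpair.1.unpair.2 = c'
  generalize j.unpair.2 = d
  have hden : (((b + 1) * (d + 1) - 1 : ℕ) : ℚ) + 1 = ((b : ℚ) + 1) * ((d : ℚ) + 1) := by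
    have : (b + 1) * (d + 1) - 1 + 1 = (b + 1) * (d + 1) :=
      Nat.sub_add_cancel (Nat.mul_pos b.succ_pos d.succ_pos)
    exact_mod_cast this
  have hnum : ∀ u v : ℕ, (((u - v) + (v - u) : ℕ) : ℚ) = |(u : ℚ) - v| := by
    intro u v
    have : (((u - v) + (v - u) : ℕ) : ℤ) = |(u : ℤ) - v| := by
      rcases abs_cases ((u : ℤ) - v) with h | h <;> omega
    exact_mod_cast this
  have hb : (0 : ℚ) < (b : ℚ) + 1 := by positivity
  have hd : (0 : ℚ) < (d : ℚ) + 1 := by positivity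
  rw [hnum, hden, ← abs_of_pos (mul_pos hb hd), ← abs_div]
  congr 1
  push_cast
  field_simp
  ring

theorem ratDistCode_primrec : Primrec₂ ratDistCode := by
  have l : Primrec fun n : ℕ => n.unpair.1 := Primrec.fst.comp Primrec.unpair
  have r : Primrec fun n : ℕ => n.unpair.2 := Primrec.snd.comp Primrec.unpair
  have hi : Primrec fun x : ℕ × ℕ => x.1 := Primrec.fst
  have hj : Primrec fun x : ℕ × ℕ => x.2 := Primrec.snd
  have s : ∀ {f : ℕ × ℕ → ℕ}, Primrec f → Primrec fun x => f x + 1 := fun h =>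
    Primrec.succ.comp h
  have hu := Primrec.nat_add.comp
    (Primrec.nat_mul.comp (l.comp (l.comp hi)) (s (r.comp hj)))
    (Primrec.nat_mul.comp (r.comp (l.comp hj)) (s (r.comp hi)))
  have hv := Primrec.nat_add.comp
    (Primrec.nat_mul.comp (r.comp (l.comp hi)) (s (r.comp hj)))
    (Primrec.nat_mul.comp (l.comp (l.comp hj)) (s (r.comp hi)))
  exact Primrec₂.natPair.comp
    (Primrec.nat_add.comp (Primrec.nat_sub.comp hu hv) (Primrec.nat_sub.comp hv hu))
    (Primrec.nat_sub.comp (Primrec.nat_mul.comp (s (r.comp hi)) (s (r.comp hj)))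
      (Primrec.const 1))

/-- `ℝ` with the Euclidean metric and the effective enumeration of the rationals. -/
noncomputable def realMetric : ComputableMetric ℝ where
  α n := (ratEnum n : ℝ)
  dense := Rat.isDenseEmbedding_coe_real.dense.comp ratEnum_surjective.denseRange
    Rat.continuous_coe_real
  computable_dist := by
    refine ⟨fun x => ratDistCode x.1 x.2.1, (ratDistCode_primrec.comp Primrec.fst
      (Primrec.fst.comp Primrec.snd)).to_comp, fun i j k => ?_⟩
    have : dist (ratEnum i : ℝ) (ratEnum j : ℝ) = (nnratEnum (ratDistCode i j) : ℝ) := by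
      rw [nnratEnum_ratDistCode, Real.dist_eq]
      push_cast
      rfl
    rw [this, sub_self, abs_zero]
    positivity

end Weihrauch

namespace Weihrauch

/-!
A point `x` of the line has at most two nearest points in `A`, namely `x - d(x, A)` and
`x + d(x, A)`. Both are computable from total information on `A`, and it is semidecidable that a
candidate does not belong to `A`, this being the inequality `0 < d(candidate, A)`. Since at least
one candidate lies in `A`, `LLPO` can pick a correct one. Conversely, an instance `(p₀, p₁)` of `LLPO`
is turned into reals `e₀, e₁ ≥ 0` with `eᵢ = 0` iff `pᵢ = 0^ℕ`; the sign of a projection of `0`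
onto `{-1 - e₀, 1 + e₁}` is then a solution.

The lower cut of `d(c, A)` is semidecidable because a compact interval disjoint from `A` is covered
by the balls of a negative name with a positive Lebesgue number `δ`, so that finitely many strict
inequalities at the points of a grid of mesh below `δ` certify the disjointness; the upper cut is
read off a positive name.
-/

open Encodable Metric

/-! ### Total functions computed by oracle machines -/

/-- `f : ℕ^ℕ → α → β` is computed by an oracle machine that halts on every code of an element of
`α`; inputs and outputs are handled through their `Primcodable` codes. -/
def OracleComputable {α β : Type} [Primcodable α] [Primcodable β] (f : Baire → α → β) : Prop :=
  ∃ φ : Baire → ℕ → ℕ, RecFunctional (fun p n => Part.some (φ p n)) ∧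
    ∀ p a, φ p (encode a) = encode (f p a)

theorem RecFunctional.of_eq {Φ Ψ : Baire → ℕ →. ℕ} (hΦ : RecFunctional Φ)
    (h : ∀ p n, Φ p n = Ψ p n) : RecFunctional Ψ :=
  (funext₂ h : Φ = Ψ) ▸ hΦ

theorem RecFunctional.of_natPrimrec {f : ℕ → ℕ} (hf : Nat.Primrec f) :
    RecFunctional fun _ n => Part.some (f n) := by
  induction hf with
  | zero => exact .zero
  | succ => exact .succ
  | left => exact .left
  | right => exact .right
  | pair _ _ h₁ h₂ => simpa using h₁.pair h₂
  | comp _ _ h₁ h₂ => simpa using h₁.comp h₂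
  | @prec f g _ _ h₁ h₂ =>
    refine (h₁.prec h₂).of_eq fun _ n => ?_
    simp only [Nat.unpaired]
    induction n.unpair.2 with
    | zero => rfl
    | succ m ih => simp [ih]

theorem RecFunctional.subst {f : Baire → Baire}
    (hf : RecFunctional fun p n => Part.some (f p n)) {Φ : Baire → ℕ →. ℕ}
    (hΦ : RecFunctional Φ) : RecFunctional fun p => Φ (f p) := by
  induction hΦ with
  | zero => exact .zero
  | succ => exact .succ
  | left => exact .left
  | right => exact .right
  | oracle => exact hf
  | pair _ _ h₁ h₂ => exact h₁.pair h₂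
  | comp _ _ h₁ h₂ => exact h₁.comp h₂
  | prec _ _ h₁ h₂ => exact h₁.prec h₂
  | rfind _ h => exact h.rfind

namespace OracleComputable

variable {α β γ δ : Type} [Primcodable α] [Primcodable β] [Primcodable γ] [Primcodable δ]

theorem of_primrec {f : α → β} (hf : Primrec f) : OracleComputable fun _ a => f a := by
  refine ⟨fun _ n => (encode ((decode (α := α) n).map f)).pred,
    RecFunctional.of_natPrimrec (Nat.Primrec.pred.comp hf), fun p a => ?_⟩
  simp

theorem comp {f : Baire → β → γ} {g : Baire → α → β} (hf : OracleComputable f)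
    (hg : OracleComputable g) : OracleComputable fun p a => f p (g p a) := by
  obtain ⟨φ, hφ, hf⟩ := hf
  obtain ⟨ψ, hψ, hg⟩ := hg
  exact ⟨fun p n => φ p (ψ p n), by simpa using hφ.comp hψ, fun p a => by simp only [hg, hf]⟩

theorem prodMk {f : Baire → α → β} {g : Baire → α → γ} (hf : OracleComputable f)
    (hg : OracleComputable g) : OracleComputable fun p a => (f p a, g p a) := by
  obtain ⟨φ, hφ, hf⟩ := hf
  obtain ⟨ψ, hψ, hg⟩ := hg
  exact ⟨fun p n => Nat.pair (φ p n) (ψ p n), by simpa using hφ.pair hψ,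
    fun p a => by simp only [hg, hf, encode_prod_val]⟩

theorem comp₁ {f : β → γ} {g : Baire → α → β} (hf : Primrec f)
    (hg : OracleComputable g) : OracleComputable fun p a => f (g p a) :=
  (of_primrec hf).comp hg

theorem comp₂ {f : β → γ → δ} {g : Baire → α → β} {h : Baire → α → γ} (hf : Primrec₂ f)
    (hg : OracleComputable g) (hh : OracleComputable h) :
    OracleComputable fun p a => f (g p a) (h p a) :=
  comp₁ hf (hg.prodMk hh)

theorem const (b : β) : OracleComputable fun _ (_ : α) => b := of_primrec (Primrec.const b)

theorem query {f : Baire → α → ℕ} (hf : OracleComputable f) :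
    OracleComputable fun p a => p (f p a) :=
  comp (f := fun p n => p n) ⟨fun p n => p n, RecFunctional.oracle, fun _ _ => rfl⟩ hf

theorem nat_rec {f : Baire → α → β} {g : Baire → α × ℕ × β → β} {n : Baire → α → ℕ}
    (hf : OracleComputable f) (hg : OracleComputable g) (hn : OracleComputable n) :
    OracleComputable fun p a =>
      Nat.rec (motive := fun _ => β) (f p a) (fun m b => g p (a, m, b)) (n p a) := by
  obtain ⟨φ, hφ, hf⟩ := hf
  obtain ⟨ψ, hψ, hg⟩ := hg
  refine comp (f := fun p (x : α × ℕ) => Nat.rec (motive := fun _ => β) (f p x.1)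
    (fun m b => g p (x.1, m, b)) x.2) (g := fun p a => (a, n p a)) ?_
    ((of_primrec Primrec.id).prodMk hn)
  refine ⟨fun p k => Nat.rec (motive := fun _ => ℕ) (φ p k.unpair.1)
    (fun m b => ψ p (Nat.pair k.unpair.1 (Nat.pair m b))) k.unpair.2, ?_, ?_⟩
  · refine (hφ.prec hψ).of_eq fun p k => ?_
    beta_reduce
    induction k.unpair.2 with
    | zero => rfl
    | succ m ih => simp [ih]
  · rintro p ⟨a, k⟩
    simp only [encode_prod_val, Nat.unpair_pair, encode_nat]
    induction k with
    | zero => exact hf p a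
    | succ m ih =>
      simp only [ih, ← hg]
      rfl

theorem cond {c : Baire → α → Bool} {f g : Baire → α → β} (hc : OracleComputable c)
    (hf : OracleComputable f) (hg : OracleComputable g) :
    OracleComputable fun p a => bif c p a then f p a else g p a :=
  comp₁ (f := fun x : Bool × β × β => bif x.1 then x.2.1 else x.2.2)
    (Primrec.cond Primrec.fst (Primrec.fst.comp Primrec.snd) (Primrec.snd.comp Primrec.snd))
    (hc.prodMk (hf.prodMk hg))

theorem subst {f : Baire → Baire} {g : Baire → α → β} (hg : OracleComputable g)
    (hf : OracleComputable f) : OracleComputable fun p => g (f p) := by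
  obtain ⟨φ, hφ, hf⟩ := hf
  obtain ⟨ψ, hψ, hg⟩ := hg
  obtain rfl : f = φ := funext₂ fun p n => (hf p n).symm
  exact ⟨_, hφ.subst hψ, fun p => hg (f p)⟩

theorem isComputable {f : Baire → Baire} (hf : OracleComputable f) :
    IsComputable fun p => Part.some (f p) := by
  obtain ⟨φ, hφ, hf⟩ := hf
  obtain rfl : f = φ := funext₂ fun p n => (hf p n).symm
  exact ⟨_, hφ, fun p q => by simp only [Part.mem_some_iff, funext_iff]⟩

end OracleComputable

/-- A relation between `ℕ^ℕ` and `α` that is decided by an oracle machine. -/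
def OracleDecidable {α : Type} [Primcodable α] (P : Baire → α → Prop) : Prop :=
  ∃ c : Baire → α → Bool, OracleComputable c ∧ ∀ p a, c p a = true ↔ P p a

namespace OracleDecidable

variable {α β γ : Type} [Primcodable α] [Primcodable β] [Primcodable γ]
  {P Q : Baire → α → Prop}

theorem ite [∀ p a, Decidable (P p a)] {f g : Baire → α → β} (hP : OracleDecidable P)
    (hf : OracleComputable f) (hg : OracleComputable g) :
    OracleComputable fun p a => if P p a then f p a else g p a := by
  obtain ⟨c, hc, hcP⟩ := hP
  convert hc.cond hf hg using 3 with p a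
  by_cases h : P p a
  · rw [if_pos h, (hcP p a).2 h, cond_true]
  · rw [if_neg h, Bool.eq_false_iff.2 (mt (hcP p a).1 h), cond_false]

theorem of_primrecRel {R : β → γ → Prop} (hR : PrimrecRel R) {f : Baire → α → β}
    {g : Baire → α → γ} (hf : OracleComputable f) (hg : OracleComputable g) :
    OracleDecidable fun p a => R (f p a) (g p a) := by
  classical
  exact ⟨_, .comp₂ hR.decide hf hg, fun p a => decide_eq_true_iff⟩

theorem comp {P : Baire → β → Prop} {f : Baire → α → β} (hP : OracleDecidable P)
    (hf : OracleComputable f) : OracleDecidable fun p a => P p (f p a) :=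
  let ⟨_, hc, hcP⟩ := hP
  ⟨_, hc.comp hf, fun p a => hcP p (f p a)⟩

theorem subst {f : Baire → Baire} (hP : OracleDecidable P) (hf : OracleComputable f) :
    OracleDecidable fun p => P (f p) :=
  let ⟨_, hc, hcP⟩ := hP
  ⟨_, hc.subst hf, fun p => hcP (f p)⟩

theorem not (hP : OracleDecidable P) : OracleDecidable fun p a => ¬ P p a :=
  let ⟨_, hc, hcP⟩ := hP
  ⟨_, .comp₁ (Primrec.dom_bool Bool.not) hc, fun p a => by simp [← hcP]⟩

theorem and (hP : OracleDecidable P) (hQ : OracleDecidable Q) :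
    OracleDecidable fun p a => P p a ∧ Q p a :=
  let ⟨_, hc, hcP⟩ := hP
  let ⟨_, hd, hdQ⟩ := hQ
  ⟨_, .comp₂ (Primrec.dom_bool₂ Bool.and) hc hd, fun p a => by simp [← hcP, ← hdQ]⟩

theorem or (hP : OracleDecidable P) (hQ : OracleDecidable Q) :
    OracleDecidable fun p a => P p a ∨ Q p a :=
  let ⟨_, hc, hcP⟩ := hP
  let ⟨_, hd, hdQ⟩ := hQ
  ⟨_, .comp₂ (Primrec.dom_bool₂ Bool.or) hc hd, fun p a => by simp [← hcP, ← hdQ]⟩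

theorem forall_lt {P : Baire → α × ℕ → Prop} {n : Baire → α → ℕ} (hP : OracleDecidable P)
    (hn : OracleComputable n) : OracleDecidable fun p a => ∀ m < n p a, P p (a, m) := by
  obtain ⟨c, hc, hcP⟩ := hP
  have h := OracleComputable.nat_rec (g := fun p (x : α × ℕ × Bool) => x.2.2 && c p (x.1, x.2.1))
    (.const (α := α) true) (.comp₂ (Primrec.dom_bool₂ Bool.and)
      (.of_primrec (Primrec.snd.comp Primrec.snd))
      (hc.comp (.of_primrec (Primrec.fst.pair (Primrec.fst.comp Primrec.snd))))) hn
  refine ⟨_, h, fun p a => ?_⟩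
  beta_reduce
  induction n p a with
  | zero => simp
  | succ k ih =>
    simp only [Bool.and_eq_true, ih, hcP, Nat.lt_succ_iff_lt_or_eq, or_imp, forall_and, forall_eq]

theorem exists_lt {P : Baire → α × ℕ → Prop} {n : Baire → α → ℕ} (hP : OracleDecidable P)
    (hn : OracleComputable n) : OracleDecidable fun p a => ∃ m < n p a, P p (a, m) := by
  simpa using (hP.not.forall_lt hn).not

end OracleDecidable

theorem oracleComputable_fstPart : OracleComputable fstPart :=
  .query (.of_primrec Primrec.nat_double)

theorem oracleComputable_sndPart : OracleComputable sndPart :=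
  .query (.of_primrec Primrec.nat_double_succ)

theorem OracleComputable.join {f g : Baire → Baire} (hf : OracleComputable f)
    (hg : OracleComputable g) : OracleComputable fun p => Weihrauch.join (f p) (g p) := by
  have half : OracleComputable fun _ (n : ℕ) => n / 2 :=
    .of_primrec (Primrec.nat_div.comp Primrec.id (Primrec.const 2))
  exact OracleDecidable.ite (OracleDecidable.of_primrecRel Primrec.eq
    (.of_primrec (Primrec.nat_mod.comp Primrec.id (Primrec.const 2))) (.const 0))
    (hf.comp half) (hg.comp half)

/-- The partial function on Baire space that is computed by a functional. -/
def ofFunctional (Φ : Baire → ℕ →. ℕ) : Baire →. Baire := fun p =>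
  ⟨∀ n, (Φ p n).Dom, fun h n => (Φ p n).get (h n)⟩

theorem mem_ofFunctional {Φ : Baire → ℕ →. ℕ} {p q : Baire} :
    q ∈ ofFunctional Φ p ↔ ∀ n, q n ∈ Φ p n :=
  ⟨fun ⟨h, e⟩ n => ⟨h n, congrFun e n⟩,
    fun h => ⟨fun n => (h n).1, funext fun n => (h n).2⟩⟩

theorem isComputable_ofFunctional {Φ : Baire → ℕ →. ℕ} (hΦ : RecFunctional Φ) :
    IsComputable (ofFunctional Φ) := ⟨Φ, hΦ, fun _ _ => mem_ofFunctional⟩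

theorem OracleDecidable.exists_isComputable_search {P : Baire → ℕ × ℕ → Prop}
    (hP : OracleDecidable P) {f : ℕ → ℕ} (hf : Nat.Primrec f) :
    ∃ F : Baire →. Baire, IsComputable F ∧ ∀ p, (∀ n, ∃ v, P p (n, v)) →
      ∃ q ∈ F p, ∀ n, ∃ v, P p (n, v) ∧ q n = f v := by
  classical
  obtain ⟨φ, hφ, hφP⟩ := hP.ite (OracleComputable.const 0) (OracleComputable.const 1)
  refine ⟨_, isComputable_ofFunctional ((RecFunctional.of_natPrimrec hf).comp hφ.rfind),
    fun p hp => ?_⟩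
  have hφ_zero (n v : ℕ) : φ p (Nat.pair n v) = 0 ↔ P p (n, v) := by
    rw [show φ p (Nat.pair n v) = _ from hφP p (n, v)]
    by_cases h : P p (n, v) <;> simp [h]
  refine ⟨fun n => f (Nat.find (hp n)), mem_ofFunctional.2 fun n => ?_,
    fun n => ⟨_, Nat.find_spec (hp n), rfl⟩⟩
  refine Part.mem_bind (Nat.mem_rfind.2 ⟨?_, fun {m} hm => ?_⟩) (Part.mem_some _)
  · simpa [hφ_zero] using Nat.find_spec (hp n)
  · simpa [hφ_zero] using Nat.find_min (hp n) hm

/-! ### Semidecidable relations on represented spaces -/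

/-- A relation `S` between a represented space and `α` is semidecidable if `S x a` is witnessed by
a natural number, where an oracle machine that is given any name of `x` can check the witness. -/
def Semidecidable {X α : Type} [Primcodable α] (σ : Representation X) (S : X → α → Prop) : Prop :=
  ∃ R : Baire → α × ℕ → Prop, OracleDecidable R ∧
    ∀ {p x}, σ.Names p x → ∀ a, S x a ↔ ∃ v, R p (a, v)

theorem mem_llpo_iff {p : Baire × Baire} {i : Fin 2} :
    i ∈ LLPO.f p ↔ (∀ j j' : Fin 2, ∀ n n' : ℕ,
      ![p.1, p.2] j n ≠ 0 → ![p.1, p.2] j' n' ≠ 0 → j = j' ∧ n = n') ∧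
      ∀ n, ![p.1, p.2] i n = 0 :=
  Iff.rfl

section Represented

variable {X X' Y Y' α β : Type} [Primcodable α] [Primcodable β]
  {σ : Representation X} {σ' : Representation X'} {τ : Representation Y} {τ' : Representation Y'}

namespace Semidecidable

variable {S T : X → α → Prop}

theorem of_oracleDecidable {R : Baire → α → Prop} (hR : OracleDecidable R)
    (h : ∀ {p x}, σ.Names p x → ∀ a, S x a ↔ R p a) : Semidecidable σ S :=
  ⟨fun p a => R p a.1, hR.comp (.of_primrec Primrec.fst), fun hp a => by simp [h hp]⟩

theorem of_primrecPred {R : α → Prop} (hR : PrimrecPred R) : Semidecidable σ fun _ => R := by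
  classical
  exact of_oracleDecidable ⟨_, .of_primrec hR.decide, fun _ _ => decide_eq_true_iff⟩
    fun _ _ => Iff.rfl

theorem of_iff (hS : Semidecidable σ S) (h : ∀ x a, T x a ↔ S x a) : Semidecidable σ T :=
  let ⟨R, hR, hS⟩ := hS
  ⟨R, hR, fun hp a => (h _ a).trans (hS hp a)⟩

theorem comap {T : Y → α → Prop} (hT : Semidecidable τ T) {f : Baire → Baire}
    (hf : OracleComputable f)
    (h : ∀ {p x}, σ.Names p x → ∃ y, τ.Names (f p) y ∧ ∀ a, S x a ↔ T y a) :
    Semidecidable σ S := by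
  obtain ⟨R, hR, hRT⟩ := hT
  refine ⟨fun p => R (f p), hR.subst hf, fun hp a => ?_⟩
  obtain ⟨y, hy, hST⟩ := h hp
  rw [hST, hRT hy]

theorem of_oracleDecidable_baireRep {R : Baire → α → Prop}
    (hR : OracleDecidable R) : Semidecidable baireRep R :=
  of_oracleDecidable hR fun hp _ => by rw [show _ = _ from hp]

theorem of_baireRep {R : Baire → α → Prop} (hR : Semidecidable baireRep R)
    (h : ∀ {p x}, σ.Names p x → ∀ a, S x a ↔ R p a) : Semidecidable σ S :=
  hR.comap (f := id) (.query (.of_primrec Primrec.id)) fun hp => ⟨_, rfl, h hp⟩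

theorem comap_fst (hS : Semidecidable σ S) :
    Semidecidable (prodRep σ τ) fun z => S z.1 :=
  hS.comap oracleComputable_fstPart fun hp => ⟨_, hp.1, fun _ => Iff.rfl⟩

theorem comap_snd {T : Y → α → Prop} (hT : Semidecidable τ T) :
    Semidecidable (prodRep σ τ) fun z => T z.2 :=
  hT.comap oracleComputable_sndPart fun hp => ⟨_, hp.2, fun _ => Iff.rfl⟩

theorem comp (hS : Semidecidable σ S) {f : β → α} (hf : Primrec f) :
    Semidecidable σ fun x b => S x (f b) :=
  let ⟨_, hR, hS⟩ := hS
  ⟨_, hR.comp (.of_primrec ((hf.comp Primrec.fst).pair Primrec.snd)), fun hp b => hS hp (f b)⟩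

theorem comp_oracle {R : Baire → α → Prop} (hR : Semidecidable baireRep R) {f : Baire → β → α}
    (hf : OracleComputable f) : Semidecidable baireRep fun p b => R p (f p b) := by
  obtain ⟨Q, hQ, hQR⟩ := hR
  refine ⟨fun p b => Q p (f p b.1, b.2),
    hQ.comp ((hf.comp (.of_primrec Primrec.fst)).prodMk (.of_primrec Primrec.snd)), ?_⟩
  rintro p x (rfl : p = x) b
  exact hQR rfl (f p b)

theorem exists_nat {S : X → α × ℕ → Prop} (hS : Semidecidable σ S) :
    Semidecidable σ fun x a => ∃ n, S x (a, n) := by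
  obtain ⟨R, hR, hRS⟩ := hS
  refine ⟨fun p a => R p ((a.1, a.2.unpair.1), a.2.unpair.2), hR.comp (.of_primrec
    ((Primrec.fst.pair (Primrec.fst.comp (Primrec.unpair.comp Primrec.snd))).pair
      (Primrec.snd.comp (Primrec.unpair.comp Primrec.snd)))), fun hp a => ?_⟩
  simp only [hRS hp]
  exact ⟨fun ⟨n, v, h⟩ => ⟨Nat.pair n v, by simpa using h⟩, fun ⟨v, h⟩ => ⟨_, _, h⟩⟩

theorem and (hS : Semidecidable σ S) (hT : Semidecidable σ T) :
    Semidecidable σ fun x a => S x a ∧ T x a := by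
  obtain ⟨R, hR, hRS⟩ := hS
  obtain ⟨Q, hQ, hQT⟩ := hT
  refine ⟨fun p a => R p (a.1, a.2.unpair.1) ∧ Q p (a.1, a.2.unpair.2),
    (hR.comp (.of_primrec (Primrec.fst.pair
      (Primrec.fst.comp (Primrec.unpair.comp Primrec.snd))))).and
    (hQ.comp (.of_primrec (Primrec.fst.pair
      (Primrec.snd.comp (Primrec.unpair.comp Primrec.snd))))), fun hp a => ?_⟩
  beta_reduce
  rw [hRS hp, hQT hp]
  exact ⟨fun ⟨⟨v, hv⟩, w, hw⟩ => ⟨Nat.pair v w, by simpa using ⟨hv, hw⟩⟩,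
    fun ⟨_, hv, hw⟩ => ⟨⟨_, hv⟩, _, hw⟩⟩

theorem or (hS : Semidecidable σ S) (hT : Semidecidable σ T) :
    Semidecidable σ fun x a => S x a ∨ T x a := by
  obtain ⟨R, hR, hRS⟩ := hS
  obtain ⟨Q, hQ, hQT⟩ := hT
  exact ⟨_, hR.or hQ, fun hp a => by simp only [hRS hp, hQT hp, exists_or]⟩

theorem forall_lt {S : X → α × ℕ → Prop} (hS : Semidecidable σ S) {n : α → ℕ} (hn : Primrec n) :
    Semidecidable σ fun x a => ∀ m < n a, S x (a, m) := by
  obtain ⟨R, hR, hRS⟩ := hS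
  have hbounded : OracleDecidable fun p (a : (α × ℕ) × ℕ) => ∃ v < a.1.2, R p ((a.1.1, a.2), v) :=
    OracleDecidable.exists_lt (P := fun p (b : ((α × ℕ) × ℕ) × ℕ) => R p ((b.1.1.1, b.1.2), b.2))
      (hR.comp (.of_primrec (((Primrec.fst.comp (Primrec.fst.comp Primrec.fst)).pair
        (Primrec.snd.comp Primrec.fst)).pair Primrec.snd)))
      (.of_primrec (Primrec.snd.comp Primrec.fst))
  refine ⟨fun p a => ∀ m < n a.1, ∃ v < a.2, R p ((a.1, m), v),
    hbounded.forall_lt (.of_primrec (hn.comp Primrec.fst)), fun hp a => ?_⟩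
  simp only [hRS hp]
  refine ⟨fun h => ?_, fun ⟨_, h⟩ m hm => (h m hm).imp fun _ hv => hv.2⟩
  choose! v hv using h
  exact ⟨(Finset.range (n a)).sup v + 1, fun m hm =>
    ⟨v m, Nat.lt_succ_of_le (Finset.le_sup (Finset.mem_range.2 hm)), hv m hm⟩⟩

theorem exists_isComputable {S : X → ℕ × ℕ → Prop} (hS : Semidecidable σ S) :
    ∃ F : Baire →. Baire, IsComputable F ∧ ∀ {p x}, σ.Names p x → (∀ n, ∃ c, S x (n, c)) →
      ∃ q ∈ F p, ∀ n, S x (n, q n) := by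
  obtain ⟨R, hR, hRS⟩ := hS
  obtain ⟨F, hF, hsearch⟩ := OracleDecidable.exists_isComputable_search
    (P := fun p a => R p ((a.1, a.2.unpair.1), a.2.unpair.2))
    (hR.comp (.of_primrec
      ((Primrec.fst.pair (Primrec.fst.comp (Primrec.unpair.comp Primrec.snd))).pair
        (Primrec.snd.comp (Primrec.unpair.comp Primrec.snd))))) Nat.Primrec.left
  refine ⟨F, hF, fun {p x} hp hx => ?_⟩
  obtain ⟨q, hq, hqR⟩ := hsearch p fun n => by
    obtain ⟨c, hc⟩ := hx n
    obtain ⟨v, hv⟩ := (hRS hp _).1 hc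
    exact ⟨Nat.pair c v, by simpa using hv⟩
  refine ⟨q, hq, fun n => ?_⟩
  obtain ⟨v, hv, hqn⟩ := hqR n
  exact hqn ▸ (hRS hp _).2 ⟨_, hv⟩

theorem exists_range_eq {S : X → ℕ → Prop} (hS : Semidecidable σ S) {k₀ : ℕ}
    (hk₀ : ∀ x, S x k₀) :
    ∃ e : Baire → Baire, OracleComputable e ∧
      ∀ {p x}, σ.Names p x → Set.range (e p) = {k | S x k} := by
  classical
  obtain ⟨R, hR, hRS⟩ := hS
  refine ⟨fun p m => if R p (m.unpair.1, m.unpair.2) then m.unpair.1 else k₀,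
    (hR.comp (.of_primrec Primrec.unpair)).ite
      (.of_primrec (Primrec.fst.comp Primrec.unpair)) (.const k₀), fun {p x} hp => ?_⟩
  ext k
  refine ⟨?_, fun hk => ?_⟩
  · rintro ⟨m, rfl⟩
    by_cases hm : R p (m.unpair.1, m.unpair.2)
    · simpa only [if_pos hm] using Set.mem_ofPred.2 ((hRS hp _).2 ⟨_, hm⟩)
    · simpa only [if_neg hm] using Set.mem_ofPred.2 (hk₀ x)
  · obtain ⟨v, hv⟩ := (hRS hp k).1 hk
    exact ⟨Nat.pair k v, by simp [hv]⟩

theorem exists_flag (hS : Semidecidable σ S) :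
    ∃ e : Baire → α × ℕ → ℕ, OracleComputable e ∧ ∀ {p x}, σ.Names p x → ∀ a,
      ((∀ n, e p (a, n) = 0) ↔ ¬ S x a) ∧ {n | e p (a, n) ≠ 0}.Subsingleton := by
  classical
  obtain ⟨R, hR, hRS⟩ := hS
  have hfirst : OracleDecidable fun p (b : α × ℕ) => R p b ∧ ∀ m < b.2, ¬ R p (b.1, m) :=
    hR.and (OracleDecidable.forall_lt
      (P := fun p (c : (α × ℕ) × ℕ) => ¬ R p (c.1.1, c.2))
      (hR.not.comp (.of_primrec ((Primrec.fst.comp Primrec.fst).pair Primrec.snd)))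
      (.of_primrec Primrec.snd))
  refine ⟨fun p b => if R p b ∧ ∀ m < b.2, ¬ R p (b.1, m) then 1 else 0,
    hfirst.ite (.const 1) (.const 0), fun {p x} hp a => ⟨⟨fun h hSa => ?_, fun h n => ?_⟩, ?_⟩⟩
  · have hex := (hRS hp a).1 hSa
    exact one_ne_zero ((if_pos ⟨Nat.find_spec hex, fun m => Nat.find_min hex⟩).symm.trans
      (h (Nat.find hex)))
  · exact if_neg fun hn => h ((hRS hp a).2 ⟨n, hn.1⟩)
  · intro n hn m hm
    simp only [Set.mem_ofPred_eq, ne_eq, ite_eq_right_iff, one_ne_zero, imp_false, not_not] at hn hm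
    exact le_antisymm (not_lt.1 fun h => hn.2 m h hm.1) (not_lt.1 fun h => hm.2 n h hn.1)

/-- `LLPO` finds a false one among two semidecidable assertions that are not both true. -/
theorem exists_llpo_instance {S : X → ℕ → Prop} (hS : Semidecidable σ S) :
    ∃ K : Baire → Baire, OracleComputable K ∧ ∀ {p x}, σ.Names p x → ¬ (S x 0 ∧ S x 1) →
      ∃ z, LLPO.repX.Names (K p) z ∧ ∀ i : Fin 2, i ∈ LLPO.f z ↔ ¬ S x i := by
  obtain ⟨e, he, hflag⟩ := hS.exists_flag
  have hcomp (i : ℕ) : OracleComputable fun p n => e p (i, n) :=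
    he.comp (.of_primrec ((Primrec.const i).pair Primrec.id))
  refine ⟨_, (hcomp 0).join (hcomp 1), fun {p x} hp hx =>
    ⟨(fun n => e p (0, n), fun n => e p (1, n)), ⟨fstPart_join _ _, sndPart_join _ _⟩, fun i => ?_⟩⟩
  have hcoord (j : Fin 2) (n : ℕ) :
      ![fun n => e p (0, n), fun n => e p (1, n)] j n = e p (j, n) := by
    fin_cases j <;> rfl
  have htrue {j : Fin 2} {n : ℕ} (hn : e p (j, n) ≠ 0) : S x j :=
    not_not.1 fun h => hn (((hflag hp j).1.2 h) n)
  simp only [mem_llpo_iff, hcoord, (hflag hp i).1, and_iff_right_iff_imp]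
  intro _ j j' n n' hn hn'
  obtain rfl : j = j' := by
    by_contra hne
    obtain ⟨rfl, rfl⟩ | ⟨rfl, rfl⟩ : j = 0 ∧ j' = 1 ∨ j = 1 ∧ j' = 0 := by omega
    · exact hx ⟨htrue hn, htrue hn'⟩
    · exact hx ⟨htrue hn', htrue hn⟩
  exact ⟨rfl, (hflag hp j).2 hn hn'⟩

end Semidecidable

theorem Reducible.of_semidecidable {f : X → Set Y} {g : X' → Set Y'} {K : Baire → Baire}
    (hK : OracleComputable K) {S : X × Y' → ℕ × ℕ → Prop} (hS : Semidecidable (prodRep σ τ') S)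
    (h : ∀ {p x}, σ.Names p x → (f x).Nonempty →
      ∃ x', σ'.Names (K p) x' ∧ (g x').Nonempty ∧ ∀ y' ∈ g x',
        (∀ n, ∃ c, S (x, y') (n, c)) ∧
          ∀ q, (∀ n, S (x, y') (n, q n)) → ∃ y ∈ f x, τ.Names q y) :
    Reducible ⟨σ, τ, f⟩ ⟨σ', τ', g⟩ := by
  obtain ⟨H, hH, hHS⟩ := hS.exists_isComputable
  refine ⟨H, _, hH, hK.isComputable, fun G hG p x hp hx => ?_⟩
  obtain ⟨x', hx', hgx', hgS⟩ := h hp hx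
  obtain ⟨r, hr, y', hy', hry'⟩ := hG (K p) x' hx' hgx'
  have hjoin : (prodRep σ τ').Names (join p r) (x, y') := by
    simpa only [prodRep, fstPart_join, sndPart_join] using And.intro hp hry'
  obtain ⟨q, hq, hqS⟩ := hHS hjoin (hgS y' hy').1
  exact ⟨q, Part.mem_bind (Part.mem_some _) (Part.mem_bind hr hq), (hgS y' hy').2 q hqS⟩

end Represented

/-! ### Real-valued functions with semidecidable cuts -/

theorem primrec_unpair_fst : Primrec fun n : ℕ => n.unpair.1 := Primrec.fst.comp Primrec.unpair

theorem primrec_unpair_snd : Primrec fun n : ℕ => n.unpair.2 := Primrec.snd.comp Primrec.unpair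

/-- The difference of two rationals, on codes. -/
def ratSubCode (i j : ℕ) : ℕ :=
  Nat.pair
    (Nat.pair (i.unpair.1.unpair.1 * (j.unpair.2 + 1) + j.unpair.1.unpair.2 * (i.unpair.2 + 1))
      (i.unpair.1.unpair.2 * (j.unpair.2 + 1) + j.unpair.1.unpair.1 * (i.unpair.2 + 1)))
    ((i.unpair.2 + 1) * (j.unpair.2 + 1) - 1)

theorem ratEnum_ratSubCode (i j : ℕ) : ratEnum (ratSubCode i j) = ratEnum i - ratEnum j := by
  simp only [ratSubCode, ratEnum, Nat.unpair_pair]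
  generalize i.unpair.1.unpair.1 = a
  generalize i.unpair.1.unpair.2 = a'
  generalize i.unpair.2 = b
  generalize j.unpair.1.unpair.1 = c
  generalize j.unpair.1.unpair.2 = c'
  generalize j.unpair.2 = d
  have hden : (((b + 1) * (d + 1) - 1 : ℕ) : ℚ) + 1 = ((b : ℚ) + 1) * ((d : ℚ) + 1) := by
    have : (b + 1) * (d + 1) - 1 + 1 = (b + 1) * (d + 1) :=
      Nat.sub_add_cancel (Nat.mul_pos b.succ_pos d.succ_pos)
    exact_mod_cast this
  rw [hden]
  push_cast
  field_simp
  ring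

theorem ratSubCode_primrec : Primrec₂ ratSubCode := by
  have l := primrec_unpair_fst
  have r := primrec_unpair_snd
  have hi : Primrec fun x : ℕ × ℕ => x.1 := Primrec.fst
  have hj : Primrec fun x : ℕ × ℕ => x.2 := Primrec.snd
  have succ : ∀ {f : ℕ × ℕ → ℕ}, Primrec f → Primrec fun x => f x + 1 := fun h =>
    Primrec.succ.comp h
  have hpos := Primrec.nat_add.comp
    (Primrec.nat_mul.comp (l.comp (l.comp hi)) (succ (r.comp hj)))
    (Primrec.nat_mul.comp (r.comp (l.comp hj)) (succ (r.comp hi)))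
  have hneg := Primrec.nat_add.comp
    (Primrec.nat_mul.comp (r.comp (l.comp hi)) (succ (r.comp hj)))
    (Primrec.nat_mul.comp (l.comp (l.comp hj)) (succ (r.comp hi)))
  exact Primrec₂.natPair.comp (Primrec₂.natPair.comp hpos hneg)
    (Primrec.nat_sub.comp (Primrec.nat_mul.comp (succ (r.comp hi)) (succ (r.comp hj)))
      (Primrec.const 1))

theorem ratEnum_neg_iff (i : ℕ) : ratEnum i < 0 ↔ i.unpair.1.unpair.1 < i.unpair.1.unpair.2 := by
  have h : (0 : ℚ) < (i.unpair.2 : ℚ) + 1 := by positivity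
  rw [ratEnum, div_lt_iff₀ h, zero_mul, sub_neg, Nat.cast_lt]

theorem primrecRel_ratEnum_lt : PrimrecRel fun i j => ratEnum i < ratEnum j := by
  refine (Primrec.nat_lt.comp
    (primrec_unpair_fst.comp (primrec_unpair_fst.comp ratSubCode_primrec))
    (primrec_unpair_snd.comp (primrec_unpair_fst.comp ratSubCode_primrec))).of_eq fun i => ?_
  rw [← ratEnum_neg_iff, ratEnum_ratSubCode, sub_neg]

theorem ratEnum_pair_zero (m n : ℕ) :
    ratEnum (Nat.pair (Nat.pair m 0) n) = (m : ℚ) / (n + 1) := by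
  simp [ratEnum]

theorem exists_ratEnum_btwn {x y : ℝ} (h : x < y) : ∃ i, x < ratEnum i ∧ (ratEnum i : ℝ) < y := by
  obtain ⟨q, hxq, hqy⟩ := exists_rat_btwn h
  obtain ⟨i, rfl⟩ := ratEnum_surjective q
  exact ⟨i, hxq, hqy⟩

/-- A family of reals `f x a`, with `x` in a represented space, is computable if the lower and the
upper Dedekind cut of `f x a` are semidecidable; the rational `ratEnum i` enters through its
code `i`. -/
structure ComputableReal {X α : Type} [Primcodable α] (σ : Representation X) (f : X → α → ℝ) :
    Prop where
  lower : Semidecidable σ fun x (b : α × ℕ) => (ratEnum b.2 : ℝ) < f x b.1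
  upper : Semidecidable σ fun x (b : α × ℕ) => f x b.1 < ratEnum b.2

namespace ComputableReal

variable {X Y α β : Type} [Primcodable α] [Primcodable β]
  {σ : Representation X} {τ : Representation Y} {f g : X → α → ℝ}

theorem ratEnum {c : α → ℕ} (hc : Primrec c) :
    ComputableReal σ fun _ a => (Weihrauch.ratEnum (c a) : ℝ) where
  lower := (Semidecidable.of_primrecPred (primrecRel_ratEnum_lt.comp Primrec.snd
    (hc.comp Primrec.fst))).of_iff fun _ _ => Rat.cast_lt
  upper := (Semidecidable.of_primrecPred (primrecRel_ratEnum_lt.comp (hc.comp Primrec.fst)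
    Primrec.snd)).of_iff fun _ _ => Rat.cast_lt

theorem natDiv {m n : α → ℕ} (hm : Primrec m) (hn : Primrec n) :
    ComputableReal σ fun _ a => (m a : ℝ) / (n a + 1) := by
  simpa [ratEnum_pair_zero] using
    ratEnum (σ := σ) (Primrec₂.natPair.comp (Primrec₂.natPair.comp hm (.const 0)) hn)

theorem natCast (m : ℕ) : ComputableReal σ fun _ (_ : α) => (m : ℝ) := by
  simpa using natDiv (σ := σ) (.const (α := α) m) (.const 0)

theorem nnratEnum {c : α → ℕ} (hc : Primrec c) :
    ComputableReal σ fun _ a => (Weihrauch.nnratEnum (c a) : ℝ) := by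
  simpa [Weihrauch.nnratEnum] using
    natDiv (σ := σ) (primrec_unpair_fst.comp hc) (primrec_unpair_snd.comp hc)

theorem half_pow {n : α → ℕ} (hn : Primrec n) :
    ComputableReal σ fun _ a => (1 / 2 : ℝ) ^ n a := by
  have hpow : Primrec fun a => 2 ^ n a - 1 :=
    Primrec.nat_sub.comp ((Primrec₂.unpaired'.1 Nat.Primrec.pow).comp (.const 2) hn) (.const 1)
  convert natDiv (σ := σ) (.const 1) hpow using 3 with _ a
  rw [Nat.cast_sub Nat.one_le_two_pow]
  simp

theorem comap_fst (hf : ComputableReal σ f) :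
    ComputableReal (prodRep σ τ) fun z => f z.1 where
  lower := hf.lower.comap_fst
  upper := hf.upper.comap_fst

theorem comap_snd {g : Y → α → ℝ} (hg : ComputableReal τ g) :
    ComputableReal (prodRep σ τ) fun z => g z.2 where
  lower := hg.lower.comap_snd
  upper := hg.upper.comap_snd

theorem comp (hf : ComputableReal σ f) {k : β → α} (hk : Primrec k) :
    ComputableReal σ fun x b => f x (k b) where
  lower := hf.lower.comp (f := fun b : β × ℕ => (k b.1, b.2))
    ((hk.comp Primrec.fst).pair Primrec.snd)
  upper := hf.upper.comp (f := fun b : β × ℕ => (k b.1, b.2))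
    ((hk.comp Primrec.fst).pair Primrec.snd)

theorem comp_oracle {f : Baire → α → ℝ} (hf : ComputableReal baireRep f) {k : Baire → β → α}
    (hk : OracleComputable k) : ComputableReal baireRep fun p b => f p (k p b) := by
  have hk' : OracleComputable fun p (b : β × ℕ) => (k p b.1, b.2) :=
    (hk.comp (.of_primrec Primrec.fst)).prodMk (.of_primrec Primrec.snd)
  exact ⟨hf.lower.comp_oracle (f := fun p (b : β × ℕ) => (k p b.1, b.2)) hk',
    hf.upper.comp_oracle (f := fun p (b : β × ℕ) => (k p b.1, b.2)) hk'⟩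

theorem lt (hf : ComputableReal σ f) (hg : ComputableReal σ g) :
    Semidecidable σ fun x a => f x a < g x a :=
  (hf.upper.and hg.lower).exists_nat.of_iff fun _ _ =>
    ⟨exists_ratEnum_btwn, fun ⟨_, hl, hr⟩ => hl.trans hr⟩

theorem neg (hf : ComputableReal σ f) : ComputableReal σ fun x a => -f x a := by
  have hcode : Primrec fun b : α × ℕ => (b.1, ratSubCode 0 b.2) :=
    Primrec.fst.pair (ratSubCode_primrec.comp (.const 0) Primrec.snd)
  have hzero (i : ℕ) : (Weihrauch.ratEnum (ratSubCode 0 i) : ℝ) = -Weihrauch.ratEnum i := by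
    rw [ratEnum_ratSubCode]
    simp [Weihrauch.ratEnum]
  exact ⟨(hf.upper.comp hcode).of_iff fun x b => by rw [hzero, lt_neg],
    (hf.lower.comp hcode).of_iff fun x b => by rw [hzero, neg_lt]⟩

theorem add (hf : ComputableReal σ f) (hg : ComputableReal σ g) :
    ComputableReal σ fun x a => f x a + g x a := by
  have hf_code : Primrec fun b : (α × ℕ) × ℕ => (b.1.1, b.2) :=
    (Primrec.fst.comp Primrec.fst).pair Primrec.snd
  have hg_code : Primrec fun b : (α × ℕ) × ℕ => (b.1.1, ratSubCode b.1.2 b.2) :=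
    (Primrec.fst.comp Primrec.fst).pair
      (ratSubCode_primrec.comp (Primrec.snd.comp Primrec.fst) Primrec.snd)
  constructor
  · refine ((hf.lower.comp hf_code).and (hg.lower.comp hg_code)).exists_nat.of_iff fun x b => ?_
    simp only [ratEnum_ratSubCode, Rat.cast_sub]
    refine ⟨fun h => ?_, fun ⟨i, hi, hb⟩ => by linarith⟩
    obtain ⟨i, hi, hif⟩ := exists_ratEnum_btwn (sub_lt_iff_lt_add.2 h)
    exact ⟨i, hif, by linarith⟩
  · refine ((hf.upper.comp hf_code).and (hg.upper.comp hg_code)).exists_nat.of_iff fun x b => ?_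
    simp only [ratEnum_ratSubCode, Rat.cast_sub]
    refine ⟨fun h => ?_, fun ⟨i, hi, hb⟩ => by linarith⟩
    obtain ⟨i, hfi, hi⟩ := exists_ratEnum_btwn (lt_sub_iff_add_lt.2 h)
    exact ⟨i, hfi, by linarith⟩

theorem sub (hf : ComputableReal σ f) (hg : ComputableReal σ g) :
    ComputableReal σ fun x a => f x a - g x a := by
  simpa only [sub_eq_add_neg] using hf.add hg.neg

theorem max (hf : ComputableReal σ f) (hg : ComputableReal σ g) :
    ComputableReal σ fun x a => Max.max (f x a) (g x a) where
  lower := (hf.lower.or hg.lower).of_iff fun _ _ => lt_max_iff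
  upper := (hf.upper.and hg.upper).of_iff fun _ _ => max_lt_iff

theorem min (hf : ComputableReal σ f) (hg : ComputableReal σ g) :
    ComputableReal σ fun x a => Min.min (f x a) (g x a) where
  lower := (hf.lower.and hg.lower).of_iff fun _ _ => lt_min_iff
  upper := (hf.upper.or hg.upper).of_iff fun _ _ => min_lt_iff

theorem dist (hf : ComputableReal σ f) (hg : ComputableReal σ g) :
    ComputableReal σ fun x a => Dist.dist (f x a) (g x a) := by
  simpa only [Real.dist_eq, abs, neg_sub] using (hf.sub hg).max (hg.sub hf)

theorem ite {P : α → Prop} [DecidablePred P] (hP : PrimrecPred P) (hf : ComputableReal σ f)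
    (hg : ComputableReal σ g) : ComputableReal σ fun x a => if P a then f x a else g x a where
  lower := (((Semidecidable.of_primrecPred hP).comp Primrec.fst).and hf.lower).or
    (((Semidecidable.of_primrecPred hP.not).comp Primrec.fst).and hg.lower) |>.of_iff
    fun _ b => by by_cases h : P b.1 <;> simp [h]
  upper := (((Semidecidable.of_primrecPred hP).comp Primrec.fst).and hf.upper).or
    (((Semidecidable.of_primrecPred hP.not).comp Primrec.fst).and hg.upper) |>.of_iff
    fun _ b => by by_cases h : P b.1 <;> simp [h]

end ComputableReal

/-! ### Names of points and of closed sets -/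

section Metric

variable {X : Type} [MetricSpace X] {C : ComputableMetric X} {p : Baire} {x : X} {A : Set X}

theorem dist_le_of_cauchyRep_names (hp : (cauchyRep C).Names p x) (n : ℕ) :
    dist (C.α (p n)) x ≤ (1 / 2 : ℝ) ^ n :=
  le_of_tendsto (tendsto_const_nhds.dist hp.2)
    (Filter.eventually_atTop.2 ⟨n, fun m hm => hp.1 n m hm⟩)

theorem cauchyRep_names_of_dist_lt (h : ∀ n, dist (C.α (p n)) x < (1 / 2 : ℝ) ^ (n + 1)) :
    (cauchyRep C).Names p x := by
  refine ⟨fun i j hij => ?_, ?_⟩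
  · have hpow : (1 / 2 : ℝ) ^ (j + 1) ≤ (1 / 2 : ℝ) ^ (i + 1) :=
      pow_le_pow_of_le_one (by norm_num) (by norm_num) (by omega)
    calc dist (C.α (p i)) (C.α (p j))
        ≤ dist (C.α (p i)) x + dist (C.α (p j)) x := dist_triangle_right _ _ _
      _ ≤ (1 / 2 : ℝ) ^ (i + 1) + (1 / 2 : ℝ) ^ (i + 1) :=
        add_le_add (h i).le ((h j).le.trans hpow)
      _ = (1 / 2 : ℝ) ^ i := by ring
  · rw [tendsto_iff_dist_tendsto_zero]
    exact squeeze_zero (fun _ => dist_nonneg) (fun n => (h n).le)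
      ((tendsto_pow_atTop_nhds_zero_of_lt_one (by norm_num) (by norm_num)).comp
        (Filter.tendsto_add_atTop_nat 1))

theorem exists_nnratEnum_btwn {x y : ℝ} (hx : 0 ≤ x) (hxy : x < y) :
    ∃ m, x < nnratEnum m ∧ (nnratEnum m : ℝ) < y := by
  obtain ⟨i, hxi, hiy⟩ := exists_ratEnum_btwn hxy
  have hi : (0 : ℚ) ≤ ratEnum i := by exact_mod_cast hx.trans hxi.le
  have hcode : nnratEnum (ratDistCode i 0) = ratEnum i := by
    rw [nnratEnum_ratDistCode, show ratEnum 0 = 0 by simp [ratEnum], sub_zero, abs_of_nonneg hi]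
  exact ⟨ratDistCode i 0, by rwa [hcode], by rwa [hcode]⟩

/-- The closed ball with the center and the radius of `basicBall C k`; this may be strictly larger
than the closure of `basicBall C k`. -/
def closedBasicBall (C : ComputableMetric X) (k : ℕ) : Set X :=
  closedBall (C.α k.unpair.1) (nnratEnum k.unpair.2 : ℝ)

theorem lt_infDist_iff (hA : A.Nonempty) {q : ℝ} :
    q < infDist x A ↔ q < 0 ∨ ∃ k : ℕ, dist x (C.α k.unpair.1) + q < nnratEnum k.unpair.2 ∧
      Disjoint (closedBasicBall C k) A := by
  constructor
  · refine fun h => or_iff_not_imp_left.2 fun hq => ?_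
    obtain ⟨n, hn⟩ := C.dense.exists_dist_lt x (half_pos (sub_pos.2 h))
    obtain ⟨m, hqm, hmA⟩ := exists_nnratEnum_btwn
      (add_nonneg dist_nonneg (not_lt.1 hq))
      (by linarith : dist x (C.α n) + q < infDist x A - dist x (C.α n))
    refine ⟨Nat.pair n m, by simpa using hqm, Set.disjoint_left.2 fun y hy hyA => ?_⟩
    simp only [closedBasicBall, Nat.unpair_pair, mem_closedBall] at hy
    linarith [infDist_le_dist_of_mem (x := x) hyA, dist_triangle_right x y (C.α n)]
  · rintro (hq | ⟨k, hk, hdisj⟩)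
    · exact hq.trans_le infDist_nonneg
    · refine (lt_sub_iff_add_lt'.2 hk).trans_le ((le_infDist hA).2 fun y hy => ?_)
      have hyk : nnratEnum k.unpair.2 < dist y (C.α k.unpair.1) :=
        not_le.1 fun hyk => Set.disjoint_left.1 hdisj hyk hy
      linarith [dist_triangle_left y (C.α k.unpair.1) x]

theorem infDist_lt_iff_exists_basicBall (hA : A.Nonempty) {q : ℝ} :
    infDist x A < q ↔ ∃ k : ℕ, (basicBall C k ∩ A).Nonempty ∧
      dist x (C.α k.unpair.1) + nnratEnum k.unpair.2 < q := by
  rw [infDist_lt_iff hA]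
  constructor
  · rintro ⟨y, hy, hxy⟩
    have hε : 0 < (q - dist x y) / 2 := by linarith
    obtain ⟨n, hn⟩ := C.dense.exists_dist_lt y hε
    obtain ⟨m, hnm, hm⟩ := exists_nnratEnum_btwn dist_nonneg hn
    refine ⟨Nat.pair n m, ⟨y, by simpa [basicBall] using hnm, hy⟩, ?_⟩
    simp only [Nat.unpair_pair]
    linarith [dist_triangle x y (C.α n)]
  · rintro ⟨k, ⟨y, hyk, hy⟩, hk⟩
    exact ⟨y, hy, by linarith [dist_triangle_right x y (C.α k.unpair.1), mem_ball.1 hyk]⟩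

theorem NegName.exists_forall_dist_add_lt (hp : NegName C p A) {K : Set X} (hK : IsCompact K)
    (hKA : Disjoint K A) :
    ∃ δ > 0, ∀ z ∈ K, ∃ i, dist z (C.α (p i).unpair.1) + δ < nnratEnum (p i).unpair.2 := by
  refine hK.induction_on (p := fun s => ∃ δ > 0, ∀ z ∈ s, ∃ i,
    dist z (C.α (p i).unpair.1) + δ < nnratEnum (p i).unpair.2) ⟨1, one_pos, by simp⟩
    (fun s t hst ⟨δ, hδ, ht⟩ => ⟨δ, hδ, fun z hz => ht z (hst hz)⟩) ?_ fun z hz => ?_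
  · rintro s t ⟨δ, hδ, hs⟩ ⟨ε, hε, ht⟩
    refine ⟨min δ ε, lt_min hδ hε, ?_⟩
    rintro z (hz | hz)
    · exact (hs z hz).imp fun i hi => (add_le_add_right (min_le_left δ ε) _).trans_lt hi
    · exact (ht z hz).imp fun i hi => (add_le_add_right (min_le_right δ ε) _).trans_lt hi
  · have hzA : z ∉ A := Set.disjoint_left.1 hKA hz
    rw [hp, Set.notMem_compl_iff, Set.biUnion_range, Set.mem_iUnion] at hzA
    obtain ⟨i, hi⟩ := hzA
    set δ := (nnratEnum (p i).unpair.2 - dist z (C.α (p i).unpair.1)) / 2 with hδ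
    have hδ_pos : 0 < δ := by linarith [mem_ball.1 hi]
    refine ⟨ball z δ, mem_nhdsWithin_of_mem_nhds (ball_mem_nhds z hδ_pos), δ, hδ_pos,
      fun w hw => ⟨i, ?_⟩⟩
    linarith [dist_triangle w z (C.α (p i).unpair.1), mem_ball.1 hw]

theorem semidecidable_basicBall_inter_nonempty :
    Semidecidable (totalRep C) fun A k => (basicBall C k ∩ A.1).Nonempty := by
  have hrange : Semidecidable baireRep fun p k => ∃ i, p i = k :=
    (Semidecidable.of_oracleDecidable_baireRep (R := fun p (b : ℕ × ℕ) => p b.2 = b.1)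
      (.of_primrecRel Primrec.eq (.query (.of_primrec Primrec.snd))
        (.of_primrec Primrec.fst))).exists_nat
  exact hrange.comap oracleComputable_sndPart fun hp => ⟨_, rfl, fun k => (hp.2 k).symm⟩

theorem eq_compl_iUnion_basicBall (hA : IsClosed A ∧ A.Nonempty) :
    A = (⋃ k ∈ {k : ℕ | k = 0 ∨ (nnratEnum k.unpair.2 : ℝ) < infDist (C.α k.unpair.1) A},
      basicBall C k)ᶜ := by
  ext x
  simp only [Set.mem_compl_iff, Set.mem_iUnion, not_exists, Set.mem_ofPred_eq]
  constructor
  · rintro hx k (rfl | hk) hxk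
    · simp [basicBall, nnratEnum] at hxk
    · exact (hk.trans_le (infDist_le_dist_of_mem hx)).not_gt (mem_ball'.1 hxk)
  · intro h
    by_contra hx
    obtain ⟨n, hn⟩ := C.dense.exists_dist_lt x
      (half_pos ((hA.1.notMem_iff_infDist_pos hA.2).1 hx))
    obtain ⟨m, hnm, hm⟩ := exists_nnratEnum_btwn dist_nonneg
      (by linarith [infDist_le_infDist_add_dist (s := A) (x := x) (y := C.α n)] :
        dist x (C.α n) < infDist (C.α n) A)
    exact h (Nat.pair n m) (Or.inr (by simpa using hm)) (by simpa [basicBall] using hnm)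

theorem exists_totalRep_names {Z : Type} {σ : Representation Z} {A : Z → NonemptyClosed X}
    (hA : ComputableReal σ fun z k => infDist (C.α k) (A z).1) {k₀ : ℕ}
    (hk₀ : ∀ z, (basicBall C k₀ ∩ (A z).1).Nonempty) :
    ∃ e : Baire → Baire, OracleComputable e ∧
      ∀ {p z}, σ.Names p z → (totalRep C).Names (e p) (A z) := by
  have hdist := hA.comp primrec_unpair_fst
  have hradius : ComputableReal σ fun _ (k : ℕ) => (nnratEnum k.unpair.2 : ℝ) :=
    .nnratEnum primrec_unpair_snd
  have hpos_iff (z : Z) (k : ℕ) : (basicBall C k ∩ (A z).1).Nonempty ↔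
      infDist (C.α k.unpair.1) (A z).1 < nnratEnum k.unpair.2 := by
    rw [infDist_lt_iff (A z).2.2]
    exact exists_congr fun y => by rw [Set.mem_inter_iff, and_comm, basicBall, mem_ball']
  -- `basicBall C 0` has radius `0`, so it is empty and may be enumerated by default.
  have hzero : PrimrecPred fun k : ℕ => k = 0 := Primrec.eq.comp .id (.const 0)
  obtain ⟨neg, hneg, hneg_range⟩ := Semidecidable.exists_range_eq (k₀ := 0)
    ((Semidecidable.of_primrecPred hzero).or (hradius.lt hdist)) fun _ => Or.inl rfl
  obtain ⟨pos, hpos, hpos_range⟩ := Semidecidable.exists_range_eq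
    ((hdist.lt hradius).of_iff hpos_iff) hk₀
  refine ⟨_, hneg.join hpos, fun {p z} hp => ⟨?_, fun k => ?_⟩⟩
  · rw [fstPart_join, NegName, hneg_range hp]
    exact eq_compl_iUnion_basicBall (A z).2
  · rw [sndPart_join, hpos_range hp]
    rfl

end Metric

/-! ### Computing the distance to a closed subset of the line -/

theorem exists_grid_dist_le (n : ℕ) {c r z : ℝ} (hz : z ∈ closedBall c r) :
    ∃ j : ℕ, (j : ℝ) / (n + 1) ≤ 2 * r ∧ dist z (c - r + j / (n + 1)) ≤ 1 / (n + 1) := by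
  have hn : (0 : ℝ) < n + 1 := by positivity
  obtain ⟨hcz, hzc⟩ := abs_le.1 (mem_closedBall.1 hz)
  have hle := Nat.floor_le (mul_nonneg (by linarith : 0 ≤ z - (c - r)) hn.le)
  have hlt := Nat.lt_floor_add_one ((z - (c - r)) * (n + 1))
  rw [← div_le_iff₀ hn] at hle
  rw [← lt_div_iff₀ hn, add_div] at hlt
  refine ⟨_, hle.trans (by linarith), ?_⟩
  rw [Real.dist_eq, ← sub_sub, abs_of_nonneg (sub_nonneg.2 hle)]
  exact sub_le_iff_le_add'.2 hlt.le

/-- A certificate, read off a negative name `p`, that the interval `[c - r, c + r]` is disjoint from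
the named set: the points `c - r + j / (n + 1)` with `j ≤ m` form a grid on the interval, and each
of them lies in a ball enumerated by `p`, with a margin that exceeds the mesh `1 / (n + 1)`. -/
def CoveredByGrid (p : Baire) (c r : ℝ) : Prop :=
  ∃ n m : ℕ, 2 * r < (m + 1) / (n + 1) ∧
    ∀ j < m + 1, ∃ i, dist (c - r + (j : ℕ) / (n + 1)) (ratEnum (p i).unpair.1 : ℝ) +
      1 / (n + 1) < nnratEnum (p i).unpair.2

theorem NegName.disjoint_closedBall_iff_coveredByGrid {p : Baire} {A : Set ℝ}
    (hp : NegName realMetric p A) (c : ℝ) {r : ℝ} (hr : 0 ≤ r) :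
    Disjoint (closedBall c r) A ↔ CoveredByGrid p c r := by
  constructor
  · intro hdisj
    obtain ⟨δ, hδ, hcover⟩ := hp.exists_forall_dist_add_lt (isCompact_closedBall c r) hdisj
    obtain ⟨n, hn⟩ := exists_nat_one_div_lt hδ
    have hn_pos : (0 : ℝ) < n + 1 := by positivity
    refine ⟨n, ⌊2 * r * (n + 1)⌋₊, (lt_div_iff₀ hn_pos).2 (Nat.lt_floor_add_one _),
      fun j hj => ?_⟩
    have hj' : (j : ℝ) / (n + 1) ≤ 2 * r :=
      (div_le_iff₀ hn_pos).2 ((Nat.le_floor_iff (by positivity)).1 (Nat.lt_succ_iff.1 hj))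
    have hj_nonneg : 0 ≤ (j : ℝ) / (n + 1) := by positivity
    obtain ⟨i, hi⟩ := hcover (c - r + j / (n + 1))
      (mem_closedBall.2 (abs_le.2 ⟨by linarith, by linarith⟩))
    exact ⟨i, (add_lt_add_right hn _).trans hi⟩
  · rintro ⟨n, m, hm, hcover⟩
    refine Set.disjoint_left.2 fun z hz hzA => ?_
    obtain ⟨j, hj, hzj⟩ := exists_grid_dist_le n hz
    have hjm : j < m + 1 := by
      have := (div_lt_div_iff_of_pos_right (by positivity)).1 (hj.trans_lt hm)
      exact_mod_cast this
    obtain ⟨i, hi⟩ := hcover j hjm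
    rw [hp] at hzA
    refine hzA (Set.mem_biUnion ⟨i, rfl⟩ (mem_ball.2 ?_))
    calc dist z (ratEnum (p i).unpair.1 : ℝ)
        ≤ dist z (c - r + j / (n + 1)) + dist (c - r + j / (n + 1)) (ratEnum (p i).unpair.1 : ℝ) :=
          dist_triangle _ _ _
      _ ≤ dist (c - r + j / (n + 1)) (ratEnum (p i).unpair.1 : ℝ) + 1 / (n + 1) := by linarith
      _ < nnratEnum (p i).unpair.2 := hi

theorem semidecidable_coveredByGrid :
    Semidecidable baireRep fun p (k : ℕ) =>
      CoveredByGrid p (ratEnum k.unpair.1) (nnratEnum k.unpair.2) := by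
  have hk : Primrec fun b : (((ℕ × ℕ) × ℕ) × ℕ) × ℕ => b.1.1.1.1 :=
    Primrec.fst.comp (Primrec.fst.comp (Primrec.fst.comp Primrec.fst))
  have hn : Primrec fun b : (((ℕ × ℕ) × ℕ) × ℕ) × ℕ => b.1.1.1.2 :=
    Primrec.snd.comp (Primrec.fst.comp (Primrec.fst.comp Primrec.fst))
  have hj : Primrec fun b : (((ℕ × ℕ) × ℕ) × ℕ) × ℕ => b.1.2 := Primrec.snd.comp Primrec.fst
  have hi : OracleComputable fun p (b : (((ℕ × ℕ) × ℕ) × ℕ) × ℕ) => p b.2 :=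
    .query (.of_primrec Primrec.snd)
  have hmesh : ComputableReal baireRep fun _ (b : (((ℕ × ℕ) × ℕ) × ℕ) × ℕ) =>
      1 / ((b.1.1.1.2 : ℝ) + 1) := by
    simpa only [Nat.cast_one] using ComputableReal.natDiv (.const 1) hn
  have hpoint := ((ComputableReal.ratEnum (σ := baireRep) (primrec_unpair_fst.comp hk)).sub
    (.nnratEnum (primrec_unpair_snd.comp hk))).add (.natDiv hj hn)
  have hcover := ((hpoint.dist ((ComputableReal.ratEnum primrec_unpair_fst).comp_oracle hi)).add
    hmesh).lt ((ComputableReal.nnratEnum primrec_unpair_snd).comp_oracle hi)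
  have hcovers := hcover.exists_nat.forall_lt (n := fun b : (ℕ × ℕ) × ℕ => b.2 + 1)
    (Primrec.succ.comp Primrec.snd)
  have hlength : Semidecidable baireRep fun _ (b : (ℕ × ℕ) × ℕ) =>
      2 * (nnratEnum b.1.1.unpair.2 : ℝ) < ((b.2 : ℝ) + 1) / (b.1.2 + 1) := by
    have hradius : ComputableReal baireRep fun _ (b : (ℕ × ℕ) × ℕ) =>
        (nnratEnum b.1.1.unpair.2 : ℝ) :=
      .nnratEnum (primrec_unpair_snd.comp (Primrec.fst.comp Primrec.fst))
    simpa only [two_mul, Nat.cast_succ] using (hradius.add hradius).lt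
      (.natDiv (Primrec.succ.comp Primrec.snd) (Primrec.snd.comp Primrec.fst))
  exact (hlength.and hcovers).exists_nat.exists_nat

theorem semidecidable_disjoint_closedBasicBall :
    Semidecidable (totalRep realMetric) fun A k => Disjoint (closedBasicBall realMetric k) A.1 :=
  semidecidable_coveredByGrid.comap oracleComputable_fstPart fun hp =>
    ⟨_, rfl, fun k => hp.1.disjoint_closedBall_iff_coveredByGrid _
      (Rat.cast_nonneg.2 (by rw [nnratEnum]; positivity))⟩

theorem ComputableReal.infDist {X α : Type} [Primcodable α] {σ : Representation X}
    {f : X × NonemptyClosed ℝ → α → ℝ} (hf : ComputableReal (prodRep σ (totalRep realMetric)) f) :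
    ComputableReal (prodRep σ (totalRep realMetric)) fun z a => Metric.infDist (f z a) z.2.1 := by
  have hcode : Primrec fun b : (α × ℕ) × ℕ => b.2 := Primrec.snd
  have hq : Primrec fun b : (α × ℕ) × ℕ => b.1.2 := Primrec.snd.comp Primrec.fst
  have hdist := (hf.comp (Primrec.fst.comp (Primrec.fst (α := α × ℕ) (β := ℕ)))).dist
    (.ratEnum (primrec_unpair_fst.comp hcode))
  have hradius : ComputableReal (prodRep σ (totalRep realMetric)) fun _ (b : (α × ℕ) × ℕ) =>
      (Weihrauch.nnratEnum b.2.unpair.2 : ℝ) := .nnratEnum (primrec_unpair_snd.comp hcode)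
  constructor
  · exact (((ComputableReal.ratEnum Primrec.snd).lt (.natCast 0)).or
      (((hdist.add (.ratEnum hq)).lt hradius).and
        (semidecidable_disjoint_closedBasicBall.comap_snd.comp hcode)).exists_nat).of_iff
      fun z b => by rw [Nat.cast_zero]; exact lt_infDist_iff (C := realMetric) z.2.2.2
  · exact ((semidecidable_basicBall_inter_nonempty.comap_snd.comp hcode).and
      ((hdist.add hradius).lt (.ratEnum hq))).exists_nat.of_iff
      fun z b => infDist_lt_iff_exists_basicBall (C := realMetric) z.2.2.2

theorem ComputableReal.cauchyRep_id {α : Type} [Primcodable α] :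
    ComputableReal (cauchyRep realMetric) fun x (_ : α) => x := by
  have happrox : ComputableReal baireRep fun p (b : (α × ℕ) × ℕ) =>
      (Weihrauch.ratEnum (p b.2) : ℝ) :=
    (ComputableReal.ratEnum .id).comp_oracle (.query (.of_primrec Primrec.snd))
  have hbound : ComputableReal baireRep fun _ (b : (α × ℕ) × ℕ) =>
      (Weihrauch.ratEnum b.1.2 : ℝ) := .ratEnum (Primrec.snd.comp Primrec.fst)
  have hpow : ComputableReal baireRep fun _ (b : (α × ℕ) × ℕ) => (1 / 2 : ℝ) ^ b.2 :=
    .half_pow Primrec.snd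
  have hdist {p : Baire} {x : ℝ} (hp : (cauchyRep realMetric).Names p x) (n : ℕ) :
      |(Weihrauch.ratEnum (p n) : ℝ) - x| ≤ (1 / 2) ^ n := dist_le_of_cauchyRep_names hp n
  have hsmall {x y : ℝ} (h : x < y) : ∃ n : ℕ, (1 / 2 : ℝ) ^ n < (y - x) / 2 :=
    exists_pow_lt_of_lt_one (half_pos (sub_pos.2 h)) (by norm_num)
  constructor
  · refine ((hbound.add hpow).lt happrox).exists_nat.of_baireRep fun {p x} hp b =>
      ⟨fun h => (hsmall h).imp fun n hn => ?_, fun ⟨n, hn⟩ => ?_⟩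
    all_goals linarith [abs_le.1 (hdist hp n)]
  · refine (happrox.lt (hbound.sub hpow)).exists_nat.of_baireRep fun {p x} hp b =>
      ⟨fun h => (hsmall h).imp fun n hn => ?_, fun ⟨n, hn⟩ => ?_⟩
    all_goals linarith [abs_le.1 (hdist hp n)]

/-! ### Projections compute `LLPO` -/

open Classical in
/-- A real that is `0` iff `p` is identically zero, and that is computable in `p`: the number
`2⁻ⁿ` for the least `n` with `p n ≠ 0`. -/
noncomputable def firstNonzeroPow (p : Baire) : ℝ :=
  if h : ∃ n, p n ≠ 0 then (1 / 2) ^ Nat.find h else 0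

theorem firstNonzeroPow_of_ne_zero {p : Baire} {n : ℕ} (hn : p n ≠ 0) (hlt : ∀ m < n, p m = 0) :
    firstNonzeroPow p = (1 / 2) ^ n := by
  classical
  have hex : ∃ n, p n ≠ 0 := ⟨n, hn⟩
  have hfind : Nat.find hex = n := (Nat.find_eq_iff hex).2 ⟨hn, fun m hm => not_not.2 (hlt m hm)⟩
  rw [firstNonzeroPow, dif_pos hex, hfind]

theorem firstNonzeroPow_of_forall {p : Baire} (hp : ∀ n, p n = 0) : firstNonzeroPow p = 0 :=
  dif_neg fun ⟨n, hn⟩ => hn (hp n)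

theorem forall_eq_zero_or_exists_first_ne_zero (p : Baire) :
    (∀ n, p n = 0) ∨ ∃ n, p n ≠ 0 ∧ ∀ m < n, p m = 0 := by
  classical
  refine or_iff_not_imp_left.2 fun h => ?_
  rw [not_forall] at h
  exact ⟨Nat.find h, Nat.find_spec h, fun m hm => not_not.1 (Nat.find_min h hm)⟩

theorem firstNonzeroPow_nonneg (p : Baire) : 0 ≤ firstNonzeroPow p := by
  rw [firstNonzeroPow]
  split_ifs <;> positivity

theorem firstNonzeroPow_eq_zero_iff {p : Baire} : firstNonzeroPow p = 0 ↔ ∀ n, p n = 0 := by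
  refine ⟨fun h => ?_, firstNonzeroPow_of_forall⟩
  rcases forall_eq_zero_or_exists_first_ne_zero p with hp | ⟨n, hn, hlt⟩
  · exact hp
  · rw [firstNonzeroPow_of_ne_zero hn hlt] at h
    exact absurd h (by positivity)

theorem firstNonzeroPow_le {p : Baire} {n : ℕ} (hlt : ∀ m < n, p m = 0) :
    firstNonzeroPow p ≤ (1 / 2) ^ n := by
  rcases forall_eq_zero_or_exists_first_ne_zero p with hp | ⟨k, hk, hk_lt⟩
  · rw [firstNonzeroPow_of_forall hp]
    positivity
  · rw [firstNonzeroPow_of_ne_zero hk hk_lt]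
    exact pow_le_pow_of_le_one (by norm_num) (by norm_num) (not_lt.1 fun h => hk (hlt k h))

theorem lt_firstNonzeroPow_iff {p : Baire} {q : ℝ} :
    q < firstNonzeroPow p ↔
      q < 0 ∨ ∃ n : ℕ, q < (1 / 2) ^ n ∧ p n ≠ 0 ∧ ∀ m < n, p m = 0 := by
  constructor
  · intro h
    rcases forall_eq_zero_or_exists_first_ne_zero p with hp | ⟨n, hn, hlt⟩
    · exact Or.inl (firstNonzeroPow_of_forall hp ▸ h)
    · exact Or.inr ⟨n, firstNonzeroPow_of_ne_zero hn hlt ▸ h, hn, hlt⟩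
  · rintro (hq | ⟨n, hq, hn, hlt⟩)
    · exact hq.trans_le (firstNonzeroPow_nonneg p)
    · exact hq.trans_eq (firstNonzeroPow_of_ne_zero hn hlt).symm

theorem firstNonzeroPow_lt_iff {p : Baire} {q : ℝ} :
    firstNonzeroPow p < q ↔ ∃ n : ℕ, (1 / 2) ^ n < q ∧ ∀ m < n, p m = 0 := by
  refine ⟨fun h => ?_, fun ⟨n, hq, hlt⟩ => (firstNonzeroPow_le hlt).trans_lt hq⟩
  rcases forall_eq_zero_or_exists_first_ne_zero p with hp | ⟨n, hn, hlt⟩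
  · rw [firstNonzeroPow_of_forall hp] at h
    obtain ⟨n, hn⟩ := exists_pow_lt_of_lt_one h (by norm_num : (1 / 2 : ℝ) < 1)
    exact ⟨n, hn, fun m _ => hp m⟩
  · exact ⟨n, firstNonzeroPow_of_ne_zero hn hlt ▸ h, hlt⟩

theorem ComputableReal.firstNonzeroPow {α : Type} [Primcodable α] :
    ComputableReal baireRep fun p (_ : α) => Weihrauch.firstNonzeroPow p := by
  have hbound : ComputableReal baireRep fun _ (b : (α × ℕ) × ℕ) =>
      (Weihrauch.ratEnum b.1.2 : ℝ) := .ratEnum (Primrec.snd.comp Primrec.fst)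
  have hpow : ComputableReal baireRep fun _ (b : (α × ℕ) × ℕ) => (1 / 2 : ℝ) ^ b.2 :=
    .half_pow Primrec.snd
  have hzero : OracleDecidable fun p (n : ℕ) => p n = 0 :=
    .of_primrecRel Primrec.eq (.query (.of_primrec .id)) (.const 0)
  have hnext : OracleDecidable fun p (b : (α × ℕ) × ℕ) => p b.2 ≠ 0 :=
    (hzero.comp (.of_primrec Primrec.snd)).not
  have hbefore : OracleDecidable fun p (b : (α × ℕ) × ℕ) => ∀ m < b.2, p m = 0 :=
    OracleDecidable.forall_lt (P := fun p (c : ((α × ℕ) × ℕ) × ℕ) => p c.2 = 0)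
      (hzero.comp (.of_primrec Primrec.snd)) (.of_primrec Primrec.snd)
  constructor
  · exact (((ComputableReal.ratEnum Primrec.snd).lt (.natCast 0)).or
      ((hbound.lt hpow).and
        (.of_oracleDecidable_baireRep (hnext.and hbefore))).exists_nat).of_iff
      fun p b => by rw [Nat.cast_zero]; exact lt_firstNonzeroPow_iff
  · exact ((hpow.lt hbound).and (.of_oracleDecidable_baireRep hbefore)).exists_nat.of_iff
      fun p b => firstNonzeroPow_lt_iff

theorem infDist_pair {X : Type*} [PseudoMetricSpace X] (x a b : X) :
    infDist x {a, b} = min (dist x a) (dist x b) := by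
  refine le_antisymm (le_min (infDist_le_dist_of_mem (Set.mem_insert _ _))
    (infDist_le_dist_of_mem (Set.mem_insert_of_mem _ rfl)))
    ((le_infDist (Set.insert_nonempty _ _)).2 ?_)
  rintro y (rfl | rfl)
  · exact min_le_left _ _
  · exact min_le_right _ _

/-- The two-point set whose points nearest to `0` solve the instance `p` of `LLPO`. -/
noncomputable def llpoPair (p : Baire × Baire) : NonemptyClosed ℝ :=
  ⟨{-1 - firstNonzeroPow p.1, 1 + firstNonzeroPow p.2},
    (Set.toFinite _).isClosed, Set.insert_nonempty _ _⟩

theorem computableReal_infDist_llpoPair :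
    ComputableReal (prodRep baireRep baireRep) fun p (k : ℕ) =>
      infDist (ratEnum k : ℝ) (llpoPair p).1 := by
  have hcenter : ComputableReal (prodRep baireRep baireRep) fun _ (k : ℕ) => (ratEnum k : ℝ) :=
    .ratEnum .id
  have hone : ComputableReal (prodRep baireRep baireRep) fun _ (_ : ℕ) => (1 : ℝ) := by
    simpa only [Nat.cast_one] using ComputableReal.natCast 1
  have hfst : ComputableReal (prodRep baireRep baireRep) fun p (_ : ℕ) => firstNonzeroPow p.1 :=
    ComputableReal.firstNonzeroPow.comap_fst
  have hsnd : ComputableReal (prodRep baireRep baireRep) fun p (_ : ℕ) => firstNonzeroPow p.2 :=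
    ComputableReal.firstNonzeroPow.comap_snd
  simpa only [llpoPair, infDist_pair] using
    (hcenter.dist (hone.neg.sub hfst)).min (hcenter.dist (hone.add hsnd))

theorem neg_or_pos_of_mem_llpoPair {p : Baire × Baire} {y : ℝ} (hy : y ∈ (llpoPair p).1) :
    y < 0 ∨ 0 < y := by
  have := firstNonzeroPow_nonneg p.1
  have := firstNonzeroPow_nonneg p.2
  rcases hy with rfl | rfl
  · exact Or.inl (by linarith)
  · exact Or.inr (by linarith)

theorem mem_llpo_iff_of_nonempty {p : Baire × Baire} (hp : (LLPO.f p).Nonempty) {i : Fin 2} :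
    i ∈ LLPO.f p ↔ ∀ n, ![p.1, p.2] i n = 0 :=
  let ⟨_, hj⟩ := hp
  mem_llpo_iff.trans (and_iff_right (mem_llpo_iff.1 hj).1)

theorem firstNonzeroPow_eq_zero_or {p : Baire × Baire} (hp : (LLPO.f p).Nonempty) :
    firstNonzeroPow p.1 = 0 ∨ firstNonzeroPow p.2 = 0 := by
  rw [firstNonzeroPow_eq_zero_iff, firstNonzeroPow_eq_zero_iff]
  obtain ⟨i, hi⟩ := hp
  change Fin 2 at i
  have hzero := (mem_llpo_iff_of_nonempty ⟨i, hi⟩).1 hi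
  fin_cases i
  · exact Or.inl hzero
  · exact Or.inr hzero

theorem infDist_zero_llpoPair (p : Baire × Baire) :
    infDist 0 (llpoPair p).1 = min (1 + firstNonzeroPow p.1) (1 + firstNonzeroPow p.2) := by
  have := firstNonzeroPow_nonneg p.1
  have := firstNonzeroPow_nonneg p.2
  rw [llpoPair, infDist_pair, dist_zero_left, dist_zero_left, Real.norm_eq_abs, Real.norm_eq_abs,
    abs_of_nonpos (by linarith), abs_of_nonneg (by linarith), neg_sub, sub_neg_eq_add,
    add_comm (firstNonzeroPow p.1)]

theorem mem_llpo_of_dist_eq_infDist {p : Baire × Baire} (hp : (LLPO.f p).Nonempty) {y : ℝ}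
    (hy : y ∈ (llpoPair p).1) (hdist : dist 0 y = infDist 0 (llpoPair p).1) :
    (y < 0 → (0 : Fin 2) ∈ LLPO.f p) ∧ (0 < y → (1 : Fin 2) ∈ LLPO.f p) := by
  have := firstNonzeroPow_nonneg p.1
  have := firstNonzeroPow_nonneg p.2
  rw [infDist_zero_llpoPair, dist_zero_left, Real.norm_eq_abs] at hdist
  obtain ⟨hle₁, hle₂⟩ := le_min_iff.1 hdist.le
  rw [mem_llpo_iff_of_nonempty hp, mem_llpo_iff_of_nonempty hp]
  constructor <;> intro hsign
  · rw [abs_of_neg hsign] at hle₂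
    have : firstNonzeroPow p.1 = 0 := by
      rcases hy with rfl | rfl <;> rcases firstNonzeroPow_eq_zero_or hp with h | h <;> linarith
    exact firstNonzeroPow_eq_zero_iff.1 this
  · rw [abs_of_pos hsign] at hle₁
    have : firstNonzeroPow p.2 = 0 := by
      rcases hy with rfl | rfl <;> rcases firstNonzeroPow_eq_zero_or hp with h | h <;> linarith
    exact firstNonzeroPow_eq_zero_iff.1 this

theorem basicBall_inter_llpoPair_nonempty (p : Baire × Baire) :
    (basicBall realMetric (Nat.pair 0 (Nat.pair 3 0)) ∩ (llpoPair p).1).Nonempty := by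
  refine ⟨_, ?_, Set.mem_insert _ _⟩
  have := firstNonzeroPow_nonneg p.1
  have hle : firstNonzeroPow p.1 ≤ 1 := by
    simpa only [pow_zero] using firstNonzeroPow_le (p := p.1) (n := 0) (by simp)
  have hcenter : realMetric.α 0 = 0 := by simp [realMetric, ratEnum]
  have hradius : (nnratEnum (Nat.pair 3 0) : ℝ) = 3 := by simp [nnratEnum]
  rw [basicBall, Nat.unpair_pair, hcenter, hradius, mem_ball_zero_iff, Real.norm_eq_abs, abs_lt]
  constructor <;> linarith

theorem semidecidable_sign {X : Type} {σ : Representation X} :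
    Semidecidable (prodRep σ (cauchyRep realMetric)) fun z (b : ℕ × ℕ) =>
      b.2 = 0 ∧ z.2 < 0 ∨ b.2 = 1 ∧ 0 < z.2 := by
  have hy : ComputableReal (prodRep σ (cauchyRep realMetric)) fun z (_ : ℕ × ℕ) => z.2 :=
    ComputableReal.cauchyRep_id.comap_snd
  have hzero : ComputableReal (prodRep σ (cauchyRep realMetric)) fun _ (_ : ℕ × ℕ) => (0 : ℝ) := by
    simpa only [Nat.cast_zero] using ComputableReal.natCast 0
  have hcode (m : ℕ) : PrimrecPred fun b : ℕ × ℕ => b.2 = m :=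
    Primrec.eq.comp Primrec.snd (.const m)
  exact ((Semidecidable.of_primrecPred (hcode 0)).and (hy.lt hzero)).or
    ((Semidecidable.of_primrecPred (hcode 1)).and (hzero.lt hy))

theorem llpo_reducible_proj : Reducible LLPO (Proj realMetric) := by
  obtain ⟨e, he, he_names⟩ := exists_totalRep_names (C := realMetric)
    computableReal_infDist_llpoPair basicBall_inter_llpoPair_nonempty
  have hzero_names : (cauchyRep realMetric).Names (fun _ => 0) (0 : ℝ) :=
    cauchyRep_names_of_dist_lt fun n => by simp [realMetric, ratEnum]
  refine Reducible.of_semidecidable (.join (.const 0) he) semidecidable_sign fun {p x} hp hx => ?_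
  obtain ⟨y₀, hy₀, hdist₀⟩ := (llpoPair x).2.1.exists_infDist_eq_dist (llpoPair x).2.2 0
  refine ⟨(0, llpoPair x), ⟨by simpa only [fstPart_join] using hzero_names,
    by simpa only [sndPart_join] using he_names hp⟩, ⟨y₀, hy₀, hdist₀.symm⟩, ?_⟩
  rintro y ⟨hy, hdist⟩
  have hmem := mem_llpo_of_dist_eq_infDist hx hy hdist
  refine ⟨fun _ => (neg_or_pos_of_mem_llpoPair hy).elim (fun hneg => ⟨0, .inl ⟨rfl, hneg⟩⟩)
    fun hpos => ⟨1, .inr ⟨rfl, hpos⟩⟩, fun q hq => ?_⟩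
  rcases hq 0 with ⟨hq0, hneg⟩ | ⟨hq0, hpos⟩
  · exact ⟨0, hmem.1 hneg, hq0⟩
  · exact ⟨1, hmem.2 hpos, hq0⟩

/-! ### `LLPO` computes projections on the line -/

/-- The two points of the line at distance `infDist x A` from `x`, at least one of which is a
projection of `x` onto `A`. -/
noncomputable def candidate (x : ℝ) (A : Set ℝ) (i : ℕ) : ℝ :=
  if i = 0 then x - infDist x A else x + infDist x A

theorem dist_candidate (x : ℝ) (A : Set ℝ) (i : ℕ) : dist x (candidate x A i) = infDist x A := by
  rw [candidate]
  split_ifs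
  · rw [dist_self_sub_right, Real.norm_of_nonneg infDist_nonneg]
  · rw [dist_self_add_right, Real.norm_of_nonneg infDist_nonneg]

theorem candidate_zero_or_one_mem {A : Set ℝ} (hA : IsClosed A ∧ A.Nonempty) (x : ℝ) :
    candidate x A 0 ∈ A ∨ candidate x A 1 ∈ A := by
  obtain ⟨y, hy, hdist⟩ := hA.1.exists_infDist_eq_dist hA.2 x
  simp only [candidate, if_pos, one_ne_zero, if_false, hdist, Real.dist_eq]
  rcases le_total y x with hyx | hxy
  · exact Or.inl (by rwa [abs_of_nonneg (sub_nonneg.2 hyx), sub_sub_cancel])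
  · exact Or.inr (by rwa [abs_of_nonpos (sub_nonpos.2 hxy), neg_sub, add_sub_cancel])

theorem computableReal_candidate :
    ComputableReal (prodRep (cauchyRep realMetric) (totalRep realMetric)) fun z (i : ℕ) =>
      candidate z.1 z.2.1 i := by
  have hx : ComputableReal (prodRep (cauchyRep realMetric) (totalRep realMetric))
      fun z (_ : ℕ) => z.1 := ComputableReal.cauchyRep_id.comap_fst
  exact .ite (Primrec.eq.comp .id (.const 0)) (hx.sub hx.infDist) (hx.add hx.infDist)

theorem semidecidable_candidate_notMem :
    Semidecidable (prodRep (cauchyRep realMetric) (totalRep realMetric)) fun z (i : ℕ) =>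
      candidate z.1 z.2.1 i ∉ z.2.1 :=
  ((ComputableReal.natCast 0).lt computableReal_candidate.infDist).of_iff fun z i => by
    rw [z.2.2.1.notMem_iff_infDist_pos z.2.2.2, Nat.cast_zero]

theorem semidecidable_dist_candidate_lt :
    Semidecidable (prodRep (prodRep (cauchyRep realMetric) (totalRep realMetric)) twoRep)
      fun z (b : ℕ × ℕ) => ∃ i : ℕ, (z.2 : ℕ) = i ∧
        dist (ratEnum b.2 : ℝ) (candidate z.1.1 z.1.2.1 i) < (1 / 2) ^ (b.1 + 1) := by
  have hindex : Semidecidable twoRep fun j (c : (ℕ × ℕ) × ℕ) => (j : ℕ) = c.2 :=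
    .of_oracleDecidable (R := fun p c => p 0 = c.2)
      (.of_primrecRel Primrec.eq (.query (.const 0)) (.of_primrec Primrec.snd))
      fun hp c => by rw [show _ = _ from hp]
  have hcenter : ComputableReal (prodRep (cauchyRep realMetric) (totalRep realMetric))
      fun _ (c : (ℕ × ℕ) × ℕ) => (ratEnum c.1.2 : ℝ) := .ratEnum (Primrec.snd.comp Primrec.fst)
  have hclose := (hcenter.dist (computableReal_candidate.comp Primrec.snd)).lt
    (.half_pow (Primrec.succ.comp (Primrec.fst.comp Primrec.fst)))
  exact (hindex.comap_snd.and hclose.comap_fst).exists_nat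

theorem proj_reducible_llpo : Reducible (Proj realMetric) LLPO := by
  obtain ⟨K, hK, hinstance⟩ := semidecidable_candidate_notMem.exists_llpo_instance
  refine Reducible.of_semidecidable hK semidecidable_dist_candidate_lt fun {p z} hp _ => ?_
  have hmem := candidate_zero_or_one_mem z.2.2 z.1
  obtain ⟨w, hw, hsolution⟩ := hinstance hp (not_and_or.2 (by simpa only [not_not] using hmem))
  refine ⟨w, hw, ?_, fun i hi => ⟨fun n => ?_, fun q hq => ?_⟩⟩
  · exact hmem.elim (fun h => ⟨0, (hsolution 0).2 (not_not.2 h)⟩)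
      fun h => ⟨1, (hsolution 1).2 (not_not.2 h)⟩
  · obtain ⟨c, hc⟩ := realMetric.dense.exists_dist_lt (candidate z.1 z.2.1 i)
      (by positivity : (0 : ℝ) < (1 / 2) ^ (n + 1))
    exact ⟨c, i, rfl, by rwa [dist_comm]⟩
  · refine ⟨candidate z.1 z.2.1 i, ⟨not_not.1 ((hsolution i).1 hi), dist_candidate _ _ _⟩,
      cauchyRep_names_of_dist_lt fun n => ?_⟩
    obtain ⟨_, rfl, hn⟩ := hq n
    exact hn

end Weihrauch

theorem mainTheorem6 :
    Weihrauch.Equivalent (Weihrauch.Proj Weihrauch.realMetric) Weihrauch.LLPO :=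
  ⟨Weihrauch.proj_reducible_llpo, Weihrauch.llpo_reducible_proj⟩
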